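/- Let $d, L$ be integers with $L\ge 1$, and let $\Lambda=\{-L+1,\ldots,L\}^d\subset\mathbb Z^d$ with periodic boundary conditions. Let $a_{x,\sigma}$ ($x\in\Lambda$, $\sigma=\uparrow,\downarrow$) be fermion operators on the Fock space over $\Lambda\times\{\uparrow,\downarrow\}$, i.e. $\{a_{x,\sigma},a^\dagger_{x',\sigma'}\}=\delta_{x,x'}\delta_{\sigma,\sigma'}$ and $\{a_{x,\sigma},a_{x',\sigma'}\}=0$. Put $\theta_i(x)=x^{(1)}+\cdots+x^{(i-1)}$ if $x^{(i)}\ne L$ and $\theta_i(x)=x^{(1)}+\cdots+x^{(i-1)}+1$ if $x^{(i)}=L$. A classical U(1) gauge field $\tilde A$ assigns a real number $\tilde A_{x,x+e_i}$ to every nearest-neighbour bond $\{x,x+e_i\}$ of the periodic lattice $\Lambda$, with $\tilde A_{y,x}=-\tilde A_{x,y}$. For $\kappa\in\mathbb R$ and $g\ge 0$ let $$\bar H_{\rm hop}(\tilde A)=i\kappa\sum_{\sigma=\uparrow,\downarrow}\sum_{x\in\Lambda}\sum_{i=1}^d(-1)^{\theta_i(x)}\bigl(a^\dagger_{x,\sigma}e^{i\tilde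 A_{x,x+e_i}}a_{x+e_i,\sigma}-a^\dagger_{x+e_i,\sigma}e^{-i\tilde A_{x,x+e_i}}a_{x,\sigma}\bigr),$$ $$\bar H_{\rm int}(\tilde A)=g\sum_{x\in\Lambda}\sum_{i=1}^d\bigl(e^{2i\tilde A_{x,y}}a^\dagger_{x,\uparrow}a^\dagger_{x,\downarrow}a_{y,\downarrow}a_{y,\uparrow}+e^{-2i\tilde A_{x,y}}a^\dagger_{y,\uparrow}a^\dagger_{y,\downarrow}a_{x,\downarrow}a_{x,\uparrow}\bigr)\Big|_{y=x+e_i}.$$ Then for every gauge field $\tilde A$ the Hamiltonian $\bar H_{\rm hop}(\tilde A)+\bar H_{\rm int}(\tilde A)$ is self-adjoint, and for every inverse temperature $\beta\ge 0$ $$\mathrm{Tr}\exp\bigl[-\beta\bigl(\bar H_{\rm hop}(\tilde A)+\bar H_{\rm int}(\tilde A)\bigr)\bigr]\le\mathrm{Tr}\exp\bigl[-\beta\bigl(\bar H_{\rm hop}(0)+\bar H_{\rm int}(0)\bigr)\bigr].$$ Hence $\tilde A=0$ minimizes the ground-state energy (the lowest eigenvalue) of $\bar H_{\rm hop}(\tilde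 A)+\bar H_{\rm int}(\tilde A)$ among all gauge fields. Moreover, writing the hopping phase as $e^{iA_{x,x+e_i}}=i(-1)^{\theta_i(x)}e^{i\tilde A_{x,x+e_i}}$, the configuration $\tilde A=0$ has flux $\pi$ (modulo $2\pi$) through every plaquette: for all $x\in\Lambda$ and $i\ne j$, $F=A_{x,x+e_i}+A_{x+e_i,x+e_i+e_j}+A_{x+e_i+e_j,x+e_j}+A_{x+e_j,x}$ satisfies $e^{iF}=-1$. -/

import Mathlib

open scoped Matrix

namespace PiFlux

noncomputable section

/-! ### Fermion operators on a finite set of modes -/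

section Fock

variable {M : Type*} [Fintype M] [DecidableEq M]

/-- The sign `(-1)^#{k ∈ S : k precedes m}` for an (arbitrary, fixed) enumeration of the modes. -/
def jwSign (m : M) (S : Finset M) : ℂ :=
  (-1) ^ (S.filter fun k => Fintype.equivFin M k < Fintype.equivFin M m).card

/-- The annihilation operator of the mode `m` on the fermionic Fock space over the modes `M`.
The Fock space has the orthonormal basis of occupation-number states `|S⟩`, with `S` the set of
occupied modes; `a_m |S ∪ {m}⟩ = ± |S⟩` if `m ∉ S`, and `a_m |T⟩ = 0` if `m ∉ T`. -/
def ann (m : M) : Matrix (Finset M) (Finset M) ℂ :=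
  Matrix.of fun S T => if m ∉ S ∧ T = insert m S then jwSign m S else 0

/-- The creation operator, the adjoint of the annihilation operator. -/
def cre (m : M) : Matrix (Finset M) (Finset M) ℂ :=
  (ann m)ᴴ

theorem jwSign_sq {M : Type*} [Fintype M] (m : M) (S : Finset M) : jwSign m S * jwSign m S = 1 := by
  unfold jwSign; rw [← mul_pow]; norm_num

theorem star_jwSign {M : Type*} [Fintype M] (m : M) (S : Finset M) : star (jwSign m S) = jwSign m S := by
  simp [jwSign]

theorem jwSign_insert (m n : M) (S : Finset M) (h : n ∉ S) :
    jwSign m (insert n S) =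
      (if Fintype.equivFin M n < Fintype.equivFin M m then -1 else 1) * jwSign m S := by
  unfold jwSign
  rw [Finset.filter_insert]
  split_ifs with h1
  · rw [Finset.card_insert_of_notMem (by simp [h]), pow_succ]; ring
  · simp

theorem ann_mul_ann (m n : M) (S T : Finset M) :
    (ann m * ann n) S T = if m ∉ S ∧ n ∉ insert m S ∧ T = insert n (insert m S)
      then jwSign m S * jwSign n (insert m S) else 0 := by
  rw [Matrix.mul_apply, Finset.sum_eq_single (insert m S)]
  · simp only [ann, Matrix.of_apply]; split_ifs <;> simp_all
  · intro U _ hU; simp [ann, hU]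
  · simp

/-- The anticommutation relation `{a_m, a_n} = 0`. -/
theorem ann_anticomm (m n : M) : ann m * ann n + ann n * ann m = 0 := by
  ext S T
  rw [Matrix.add_apply, ann_mul_ann, ann_mul_ann, Matrix.zero_apply]
  by_cases hmn : m = n
  · subst hmn; simp
  by_cases hm : m ∈ S
  · simp [hm]
  by_cases hn : n ∈ S
  · simp [hn]
  have h3 : n ≠ m := fun h => hmn h.symm
  have hne : Fintype.equivFin M m ≠ Fintype.equivFin M n := fun h => hmn ((Fintype.equivFin M).injective h)
  by_cases hT : T = insert n (insert m S)
  · have hT' : T = insert m (insert n S) := by rw [hT, Finset.insert_comm]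
    rw [if_pos (And.intro hm (And.intro (by simp [hn, h3]) hT)), if_pos (And.intro hn (And.intro (by simp [hm, hmn]) hT')), jwSign_insert n m S hm, jwSign_insert m n S hn]
    rcases lt_or_gt_of_ne hne with h | h
    · rw [if_pos h, if_neg (lt_asymm h)]; ring
    · rw [if_neg (lt_asymm h), if_pos h]; ring
  · have hT' : ¬ T = insert m (insert n S) := by rw [Finset.insert_comm]; exact hT
    simp [hT, hT']

theorem ann_mul_cre (m n : M) (S T : Finset M) :
    (ann m * cre n) S T = if m ∉ S ∧ n ∉ T ∧ insert m S = insert n T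
      then jwSign m S * jwSign n T else 0 := by
  rw [Matrix.mul_apply, Finset.sum_eq_single (insert m S)]
  · simp only [ann, cre, Matrix.conjTranspose_apply, Matrix.of_apply]
    split_ifs <;> simp_all [star_jwSign]
  · intro U _ hU; simp [ann, hU]
  · simp

theorem cre_mul_ann (m n : M) (S T : Finset M) :
    (cre n * ann m) S T = if n ∈ S ∧ m ∉ S.erase n ∧ T = insert m (S.erase n)
      then jwSign n (S.erase n) * jwSign m (S.erase n) else 0 := by
  rw [Matrix.mul_apply, Finset.sum_eq_single (S.erase n)]
  · simp only [ann, cre, Matrix.conjTranspose_apply, Matrix.of_apply]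
    by_cases hn : n ∈ S
    · simp [hn, Finset.insert_erase hn]
      split_ifs <;> simp_all
      left; exact star_jwSign _ _
    · have : S ≠ insert n (S.erase n) := fun h => hn (by rw [h]; simp)
      rw [if_neg (fun h => this h.2)]; simp [hn]
  · intro U _ hU
    simp only [ann, cre, Matrix.conjTranspose_apply, Matrix.of_apply]
    rw [if_neg]
    · simp
    · rintro ⟨h1, h2⟩; apply hU; rw [h2, Finset.erase_insert h1]
  · simp

/-- The anticommutation relation `{a_m, a_n†} = δ_{m,n}`. -/
theorem ann_cre_anticomm (m n : M) :
    ann m * cre n + cre n * ann m = if m = n then 1 else 0 := by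
  ext S T
  rw [Matrix.add_apply, ann_mul_cre, cre_mul_ann]
  by_cases hmn : m = n
  · subst hmn
    rw [if_pos rfl, Matrix.one_apply]
    by_cases hm : m ∈ S
    · by_cases hST : S = T
      · subst hST; simp [hm, Finset.insert_erase hm, jwSign_sq]
      · have : ¬ T = S := fun h => hST h.symm
        simp [hm, Finset.insert_erase hm, hST, this]
    · by_cases hST : S = T
      · subst hST; simp [hm, jwSign_sq]
      · simp only [hm, hST, not_false_eq_true, true_and, false_and, if_false, add_zero]
        rw [if_neg]
        rintro ⟨h1, h2⟩
        apply hST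
        rw [← Finset.erase_insert hm, h2, Finset.erase_insert h1]
  · rw [if_neg hmn, Matrix.zero_apply]
    have h3 : n ≠ m := fun h => hmn h.symm
    by_cases hc : n ∈ S ∧ m ∉ S.erase n ∧ T = insert m (S.erase n)
    · obtain ⟨hn, hm, rfl⟩ := hc
      obtain ⟨W, hW, rfl⟩ : ∃ W, n ∉ W ∧ S = insert n W := ⟨S.erase n, by simp, by rw [Finset.insert_erase hn]⟩
      rw [Finset.erase_insert hW] at hm ⊢
      have hne : Fintype.equivFin M m ≠ Fintype.equivFin M n := fun h => hmn ((Fintype.equivFin M).injective h)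
      rw [if_pos ⟨by simp [hm, hmn], by simp [hW, h3], Finset.insert_comm _ _ _⟩, if_pos ⟨by simp, hm, rfl⟩,
        jwSign_insert m n W hW, jwSign_insert n m W hm]
      have := jwSign_sq m W
      have := jwSign_sq n W
      rcases lt_or_gt_of_ne hne with h | h
      · rw [if_pos h, if_neg (not_lt.2 h.le)]; ring
      · rw [if_neg (not_lt.2 h.le), if_pos h]; ring
    · rw [if_neg hc, if_neg, add_zero]
      rintro ⟨hm, hn, h⟩
      apply hc
      have hnS : n ∈ S := by
        have : n ∈ insert m S := h ▸ Finset.mem_insert_self n T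
        simpa [h3] using this
      refine ⟨hnS, by simp [hm], ?_⟩
      rw [← Finset.erase_insert hn, ← h, Finset.erase_insert_of_ne hmn]

end Fock

/-! ### The periodic box, the modes and the gauge fields -/

/-- The box `{-L+1, …, L}^d` with periodic boundary conditions. The integer coordinate
of `x` in `{-L+1, …, L}` is `(x i).valMinAbs`. -/
abbrev Site (d L : ℕ) : Type := Fin d → ZMod (2 * L)

/-- Spin up and spin down. -/
abbrev Spin : Type := Bool

/-- Spin up. -/
abbrev up : Spin := true

/-- Spin down. -/
abbrev down : Spin := false

/-- The fermion modes `(x, σ)`. -/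
abbrev Mode (d L : ℕ) : Type := Site d L × Spin

/-- A classical U(1) gauge field: `A x i` is the value `A_{x, x + e_i}` on the bond from `x` to
`x + e_i`; the value on the reversed bond is `A_{x + e_i, x} = - A_{x, x + e_i}`. -/
abbrev GaugeField (d L : ℕ) : Type := Site d L → Fin d → ℝ

/-- The operators on the Fock space of the lattice fermions. -/
abbrev Op (d L : ℕ) : Type := Matrix (Finset (Mode d L)) (Finset (Mode d L)) ℂ

variable {d L : ℕ}

/-- The unit vector `e_i`. -/
def e (i : Fin d) : Site d L := Pi.single i 1

/-- `θ_i(x) = x^{(1)} + ⋯ + x^{(i-1)}`, plus one if `x^{(i)} = L`. -/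
def theta (i : Fin d) (x : Site d L) : ℤ :=
  (∑ j ∈ Finset.univ.filter (fun j : Fin d => j < i), (x j).valMinAbs)
    + if (x i).valMinAbs = (L : ℤ) then 1 else 0

/-! ### The flux -/

/-- The phase of the hopping amplitude `e^{i A_{x, x+e_i}} = i (-1)^{θ_i(x)} e^{i Ã_{x, x+e_i}}`. -/
def hopPhase (A : GaugeField d L) (x : Site d L) (i : Fin d) : ℂ :=
  Complex.I * (-1 : ℂ) ^ theta i x * Complex.exp (Complex.I * (A x i : ℂ))

/-- `e^{iF}` for the flux `F` through the plaquette `x, x + e_i, x + e_i + e_j, x + e_j`: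
the product of the hopping phases along its boundary; a bond that is
traversed backwards contributes the inverse phase. -/
def fluxPhase (A : GaugeField d L) (x : Site d L) (i j : Fin d) : ℂ :=
  hopPhase A x i * hopPhase A (x + e i) j * (hopPhase A (x + e j) i)⁻¹ * (hopPhase A x j)⁻¹

/-! ### The Hamiltonians -/

variable [NeZero L]

/-- The hopping Hamiltonian
`iκ ∑_σ ∑_x ∑_i (-1)^{θ_i(x)} (a†_{x,σ} e^{iA} a_{x+e_i,σ} - a†_{x+e_i,σ} e^{-iA} a_{x,σ})`. -/
def Hhop (κ : ℝ) (A : GaugeField d L) : Op d L :=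
  (Complex.I * (κ : ℂ)) • ∑ σ : Spin, ∑ x : Site d L, ∑ i : Fin d, ((-1 : ℂ) ^ theta i x) •
    (Complex.exp (Complex.I * (A x i : ℂ)) • (cre (x, σ) * ann (x + e i, σ))
      - Complex.exp (-(Complex.I * (A x i : ℂ))) • (cre (x + e i, σ) * ann (x, σ)))

/-- The gauged nearest-neighbour pairing
`g ∑_{bonds} (e^{2iA} a†_{x↑} a†_{x↓} a_{y↓} a_{y↑} + e^{-2iA} a†_{y↑} a†_{y↓} a_{x↓} a_{x↑})`,
with the bonds listed as `{x, y}`, `y = x + e_i`. -/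
def Hint (g : ℝ) (A : GaugeField d L) : Op d L :=
  (g : ℂ) • ∑ x : Site d L, ∑ i : Fin d,
    (Complex.exp (2 * Complex.I * (A x i : ℂ)) •
        (cre (x, up) * cre (x, down) * ann (x + e i, down) * ann (x + e i, up))
      + Complex.exp (-(2 * Complex.I * (A x i : ℂ))) •
        (cre (x + e i, up) * cre (x + e i, down) * ann (x, down) * ann (x, up)))

/-- The fermion Hamiltonian, hopping plus pairing. -/
def H (κ g : ℝ) (A : GaugeField d L) : Op d L := Hhop κ A + Hint g A

/-- The partition function `Tr exp(-β H)`. -/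
def Z (β κ g : ℝ) (A : GaugeField d L) : ℂ :=
  (NormedSpace.exp (-(β : ℂ) • H κ g A)).trace

end

end PiFlux

/-! The proof is reflection positivity in the form of Dyson, Lieb and Simon. Two parallel planes
bisect the periodic box. After a particle-hole and a gauge transformation on the right half, the
Fock space becomes the tensor square of that of the left half, and `-βH` takes the form `A ⊗ 1 + 1 ⊗
B + ∑ C_p ⊗ D_p`, the last sum coming from the bonds that cross a plane. When the exponential is
expanded in words, each trace factorizes, and Cauchy–Schwarz over the words separates the two halves
(`norm_sq_trace_exp_kronecker_le`).

The crossing operators are real matrices with nonnegative weights, multiplied only by unimodular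
phases of the gauge field. These phases cancel in `C ⊗ C̄`. Hence `Z(a)² ≤ Z(a₁) Z(a₂)`, where `a₁`
and `a₂` are `a` restricted to one half, extended by reflection to the other, and set to zero on the
crossing bonds (`BondMirror.norm_bondZ_sq_le`). Positivity of the pairing weights uses `g ≥ 0`; the
sign of `κ` is absorbed into the gauge transformation.

The particle-hole transformation reverses the sign of the hopping on the right. Flux `π` per
plaquette is what allows a gauge transformation to undo this sign on bonds parallel to the planes,
and the antiperiodic seam gives the crossing bonds at both planes the right sign (`latticeMirror`).

Every bond crosses some plane. Among the finitely many fields with values in `{0, ±a_b}`, consider a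
maximizer of `Z` with the most zeros. If it were nonzero on a bond, reflecting in a plane through
that bond would give two maximizers, one of them with more zeros. So the maximizer is `0`
(`bondZ_twist_le`). Letting `β → ∞` compares the ground-state energies. -/

namespace PiFlux

open scoped Kronecker
open NormedSpace Filter Topology

/-! ### The Cauchy–Schwarz inequality of Dyson, Lieb and Simon -/

section CauchySchwarz

variable {n ι : Type*} [Fintype n] [DecidableEq n]

/-- Entrywise complex conjugation of matrices. -/
noncomputable abbrev conjMat : Matrix n n ℂ →+* Matrix n n ℂ := (starRingEnd ℂ).mapMatrix

theorem conjMat_conjMat (A : Matrix n n ℂ) : conjMat (conjMat A) = A := by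
  ext i j; simp

theorem conjMat_smul (c : ℂ) (A : Matrix n n ℂ) : conjMat (c • A) = star c • conjMat A := by
  ext i j; simp

theorem trace_conjMat (A : Matrix n n ℂ) : (conjMat A).trace = star A.trace := by
  simp [Matrix.trace]

/-- The factors do not commute, so the expansion has to keep ordered words; only word by word does
the trace of Kronecker products factorize. -/
theorem sum_pow_eq_sum_words {R : Type*} [Semiring R] [Fintype ι] (x : ι → R) (k : ℕ) :
    (∑ i, x i) ^ k = ∑ w : Fin k → ι, ((List.ofFn w).map x).prod := by
  induction k with
  | zero => simp
  | succ k ih =>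
    rw [pow_succ', ih, Finset.sum_mul_sum, ← Finset.sum_product', Finset.univ_product_univ]
    refine Fintype.sum_equiv (Fin.consEquiv fun _ => ι) _ _ ?_
    rintro ⟨a, w⟩
    simp [Fin.consEquiv, List.ofFn_succ]

theorem prod_map_kronecker (F G : ι → Matrix n n ℂ) (l : List ι) :
    (l.map fun i => F i ⊗ₖ G i).prod = (l.map F).prod ⊗ₖ (l.map G).prod := by
  induction l with
  | nil => simp
  | cons a l ih => simp [ih, Matrix.mul_kronecker_mul]

theorem trace_sum_kronecker_pow [Fintype ι] (F G : ι → Matrix n n ℂ) (k : ℕ) :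
    ((∑ i, F i ⊗ₖ G i) ^ k).trace =
      ∑ w : Fin k → ι, ((List.ofFn w).map F).prod.trace * ((List.ofFn w).map G).prod.trace := by
  rw [sum_pow_eq_sum_words, Matrix.trace_sum]
  simp only [prod_map_kronecker, Matrix.trace_kronecker]

theorem trace_prod_map_conjMat (F : ι → Matrix n n ℂ) (l : List ι) :
    (l.map fun i => conjMat (F i)).prod.trace = star (l.map F).prod.trace := by
  rw [← trace_conjMat, map_list_prod, List.map_map]; rfl

theorem hasSum_trace_exp (X : Matrix n n ℂ) :
    HasSum (fun k : ℕ => ((k.factorial : ℂ))⁻¹ * (X ^ k).trace) (exp X).trace := by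
  let _ : NormedRing (Matrix n n ℂ) := Matrix.linftyOpNormedRing
  let _ : NormedAlgebra ℂ (Matrix n n ℂ) := Matrix.linftyOpNormedAlgebra
  have h := exp_series_hasSum_exp' (𝕂 := ℂ) X
  have h2 := h.map (Matrix.traceLinearMap n ℂ ℂ)
    (LinearMap.continuous_of_finiteDimensional _)
  convert h2 using 2
  simp only [Function.comp_apply, map_smul, Matrix.traceLinearMap_apply, smul_eq_mul]
  rfl

theorem continuous_matrix_exp : Continuous (exp : Matrix n n ℂ → Matrix n n ℂ) := by
  let _ : NormedRing (Matrix n n ℂ) := Matrix.linftyOpNormedRing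
  let _ : NormedAlgebra ℂ (Matrix n n ℂ) := Matrix.linftyOpNormedAlgebra
  let _ : NormedAlgebra ℚ (Matrix n n ℂ) := .restrictScalars ℚ ℂ _
  have h : CompleteSpace (Matrix n n ℂ) := inferInstance
  exact @exp_continuous (Matrix n n ℂ) _ _ h

theorem continuous_trace_exp : Continuous fun X : Matrix n n ℂ => (exp X).trace :=
  (continuous_matrix_exp).matrix_trace

/-- The trace of the exponential is a sum over words `w` of `tr F_w · tr G_w / |w|!`, an inner
product of two families of traces. Replacing `G` by `F̄` turns a summand into `|tr F_w|² / |w|!`, so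
the two factors on the right are the squared norms in Cauchy–Schwarz. It is applied to partial sums
and passed to the limit. -/
theorem norm_sq_trace_exp_sum_kronecker_le [Fintype ι] (F G : ι → Matrix n n ℂ) :
    ‖(exp (∑ i, F i ⊗ₖ G i)).trace‖ ^ 2 ≤
      (exp (∑ i, F i ⊗ₖ conjMat (F i))).trace.re *
        (exp (∑ i, conjMat (G i) ⊗ₖ G i)).trace.re := by
  have lim (F G : ι → Matrix n n ℂ) := (hasSum_trace_exp (∑ i, F i ⊗ₖ G i)).tendsto_sum_nat
  refine le_of_tendsto_of_tendsto' ((lim F G).norm.pow 2)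
    (((Complex.continuous_re.tendsto _).comp (lim F fun i => conjMat (F i))).mul
      ((Complex.continuous_re.tendsto _).comp (lim (fun i => conjMat (G i)) G))) fun N => ?_
  simp only [Function.comp_apply, trace_sum_kronecker_pow, trace_prod_map_conjMat,
    fun k (v : ℂ) (h : (Fin k → ι) → ℂ) => Finset.mul_sum Finset.univ h v, Complex.re_sum]
  simp only [Finset.sum_sigma']
  set s := (Finset.range N).sigma fun k => (Finset.univ : Finset (Fin k → ι)) with hs
  -- The weight `1/k!` is shared equally between the two families.
  set f : (Σ k, Fin k → ι) → ℝ := fun x =>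
    Real.sqrt ((x.1.factorial : ℝ))⁻¹ * ‖((List.ofFn x.2).map F).prod.trace‖ with hf
  set g : (Σ k, Fin k → ι) → ℝ := fun x =>
    Real.sqrt ((x.1.factorial : ℝ))⁻¹ * ‖((List.ofFn x.2).map G).prod.trace‖ with hg
  have hsq (k : ℕ) : Real.sqrt ((k.factorial : ℝ))⁻¹ * Real.sqrt ((k.factorial : ℝ))⁻¹ =
      ((k.factorial : ℝ))⁻¹ := Real.mul_self_sqrt (by positivity)
  have hre (k : ℕ) (z : ℂ) : (((k.factorial : ℂ))⁻¹ * (z * star z)).re =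
      (Real.sqrt ((k.factorial : ℝ))⁻¹ * ‖z‖) ^ 2 := by
    rw [Complex.star_def, Complex.mul_conj, Complex.normSq_eq_norm_sq, mul_pow, pow_two (Real.sqrt _), hsq]
    have : ((k.factorial : ℂ))⁻¹ * ((‖z‖ ^ 2 : ℝ) : ℂ) = (((k.factorial : ℝ)⁻¹ * ‖z‖ ^ 2 : ℝ) : ℂ) := by
      push_cast; rfl
    rw [this, Complex.ofReal_re]
  calc _ ≤ (∑ x ∈ s, f x * g x) ^ 2 := by
        refine pow_le_pow_left₀ (norm_nonneg _) ((norm_sum_le _ _).trans (Finset.sum_le_sum ?_)) 2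
        rintro ⟨k, w⟩ -
        simp only [hf, hg, norm_mul, norm_inv, Complex.norm_natCast]
        rw [mul_mul_mul_comm, hsq]
    _ ≤ (∑ x ∈ s, f x ^ 2) * ∑ x ∈ s, g x ^ 2 := Finset.sum_mul_sq_le_sq_mul_sq s f g
    _ = _ := by
        refine congrArg₂ (· * ·) ?_ ?_
        · exact Finset.sum_congr rfl fun x _ => (hre _ _).symm
        · exact Finset.sum_congr rfl fun x _ => by rw [mul_comm (star _), hre]

theorem exp_smul_one_add (c : ℂ) (X : Matrix n n ℂ) :
    exp (c • (1 : Matrix n n ℂ) + X) = Complex.exp c • exp X := by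
  rw [Matrix.exp_add_of_commute _ _ ((Commute.one_left X).smul_left c)]
  have : c • (1 : Matrix n n ℂ) = Matrix.diagonal fun _ => c := by
    rw [Matrix.smul_one_eq_diagonal]
  rw [this, Matrix.exp_diagonal]
  have h2 : (exp fun _ : n => c) = fun _ : n => Complex.exp c := by
    funext i; rw [Pi.coe_exp, Complex.exp_eq_exp_ℂ]
  rw [h2, ← Matrix.smul_one_eq_diagonal, smul_mul_assoc, one_mul]

/-- The Cauchy–Schwarz inequality that underlies reflection positivity:
`|Tr exp(A⊗1 + 1⊗B + ∑ C_i⊗D_i)|²` is at most the product of the same traces for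
`(A, Ā, C, C̄)` and `(B̄, B, D̄, D)`. -/
theorem norm_sq_trace_exp_kronecker_le [Fintype ι] (A B : Matrix n n ℂ)
    (C D : ι → Matrix n n ℂ) :
    ‖(exp (A ⊗ₖ 1 + 1 ⊗ₖ B + ∑ i, C i ⊗ₖ D i)).trace‖ ^ 2 ≤
      (exp (A ⊗ₖ 1 + 1 ⊗ₖ conjMat A + ∑ i, C i ⊗ₖ conjMat (C i))).trace.re *
        (exp (conjMat B ⊗ₖ 1 + 1 ⊗ₖ B + ∑ i, conjMat (D i) ⊗ₖ D i)).trace.re := by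
  let K (A B : Matrix n n ℂ) (C D : ι → Matrix n n ℂ) (t : ℝ) : Matrix (n × n) (n × n) ℂ :=
    A ⊗ₖ 1 + 1 ⊗ₖ B + ((t ^ 2 : ℝ) : ℂ) • (A ⊗ₖ B) + ∑ i, C i ⊗ₖ D i
  -- One more summand brings `A ⊗ 1 + 1 ⊗ B` into product form: `t⁻¹(1 + t²A) ⊗ t⁻¹(1 + t²B)` equals
  -- `t⁻² + A ⊗ 1 + 1 ⊗ B + t² A ⊗ B`. The scalar `t⁻²` contributes the same factor `exp(t⁻²)²` to
  -- both sides and cancels; the error `t² A ⊗ B` vanishes as `t → 0⁺`.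
  let F (A : Matrix n n ℂ) (C : ι → Matrix n n ℂ) (t : ℝ) : Option ι → Matrix n n ℂ :=
    fun o => o.elim (((t⁻¹ : ℝ) : ℂ) • (1 + ((t ^ 2 : ℝ) : ℂ) • A)) C
  have hFc (A C t) (o : Option ι) : F (conjMat A) (fun i => conjMat (C i)) t o = conjMat (F A C t o) := by
    cases o
    · simp only [F, Option.elim, conjMat_smul, map_add, map_one]
      simp
    · rfl
  have hF (A B C D) {t : ℝ} (ht : 0 < t) :
      ∑ o, F A C t o ⊗ₖ F B D t o = ((t⁻¹ ^ 2 : ℝ) : ℂ) • 1 + K A B C D t := by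
    rw [Fintype.sum_option]
    simp only [F, K, Option.elim, ← add_assoc]
    congr 1
    have h : (t : ℂ) ≠ 0 := by exact_mod_cast ht.ne'
    simp only [Matrix.smul_kronecker, Matrix.kronecker_smul, Matrix.add_kronecker,
      Matrix.kronecker_add, smul_add, smul_smul, Matrix.one_kronecker_one]
    push_cast
    have e2 : (t : ℂ)⁻¹ * (t : ℂ)⁻¹ = (t : ℂ)⁻¹ ^ 2 := by ring
    have e3 : (t : ℂ)⁻¹ * ((t : ℂ)⁻¹ * (t : ℂ) ^ 2) = 1 := by field_simp
    have e4 : (t : ℂ)⁻¹ * (t : ℂ) ^ 2 * (t : ℂ)⁻¹ = 1 := by field_simp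
    have e5 : (t : ℂ)⁻¹ * (t : ℂ) ^ 2 * ((t : ℂ)⁻¹ * (t : ℂ) ^ 2) = (t : ℂ) ^ 2 := by field_simp
    simp only [e2, e3, e4, e5, one_smul]
    abel
  have key {t : ℝ} (ht : 0 < t) : ‖(exp (K A B C D t)).trace‖ ^ 2 ≤
      (exp (K A (conjMat A) C (fun i => conjMat (C i)) t)).trace.re *
        (exp (K (conjMat B) B (fun i => conjMat (D i)) D t)).trace.re := by
    have h := norm_sq_trace_exp_sum_kronecker_le (F A C t) (F B D t)
    simp only [← hFc, hF _ _ _ _ ht, exp_smul_one_add, Matrix.trace_smul, smul_eq_mul,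
      norm_mul, ← Complex.ofReal_exp, Complex.re_ofReal_mul, Complex.norm_real,
      Real.norm_eq_abs, Real.abs_exp] at h
    have hpos := Real.exp_pos (t⁻¹ ^ 2)
    rw [mul_pow, mul_mul_mul_comm, ← pow_two] at h
    exact le_of_mul_le_mul_left h (by positivity)
  have hK (A B C D) : Tendsto (fun t : ℝ => (exp (K A B C D t)).trace) (𝓝[>] 0)
      (𝓝 (exp (A ⊗ₖ 1 + 1 ⊗ₖ B + ∑ i, C i ⊗ₖ D i)).trace) := by
    have hc : Continuous (K A B C D) := by fun_prop
    have := ((continuous_trace_exp.comp hc).tendsto 0).mono_left (nhdsWithin_le_nhds (s := Set.Ioi 0))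
    simpa [K, Function.comp_def] using this
  refine le_of_tendsto_of_tendsto ((hK A B C D).norm.pow 2)
    (((Complex.continuous_re.tendsto _).comp (hK A (conjMat A) C fun i => conjMat (C i))).mul
      ((Complex.continuous_re.tendsto _).comp (hK (conjMat B) B (fun i => conjMat (D i)) D))) ?_
  filter_upwards [self_mem_nhdsWithin] with t ht using key ht

end CauchySchwarz

end PiFlux

namespace PiFlux

open scoped Kronecker
open NormedSpace Filter Topology

/-! ### Change of the enumeration of the modes -/

section Ladder

variable {M : Type*} [Fintype M] [DecidableEq M]

/-- A multiplicative cocycle on the cube of subsets is a coboundary. -/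
theorem exists_potential (ρ : M → Finset M → ℂ) (hρ : ∀ m S, m ∉ S → ‖ρ m S‖ = 1)
    (hc : ∀ m n S, m ≠ n → m ∉ S → n ∉ S →
      ρ m S * ρ n (insert m S) = ρ n S * ρ m (insert n S)) :
    ∃ δ : Finset M → ℂ, (∀ S, ‖δ S‖ = 1) ∧ ∀ m S, m ∉ S → δ (insert m S) = δ S * ρ m S := by
  let f := Fintype.equivFin M
  -- The potential is the product of `ρ` along the path from `∅` to `S` that inserts the elements in
  -- increasing order.
  let δ : Finset M → ℂ := fun S => ∏ m ∈ S, ρ m (S.filter fun k => f k < f m)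
  have hmax (m S) (hm : m ∉ S) (h : ∀ k ∈ S, f k < f m) : δ (insert m S) = δ S * ρ m S := by
    have h1 : (insert m S).filter (fun k => f k < f m) = S := by
      rw [Finset.filter_insert, if_neg (lt_irrefl _), Finset.filter_true_of_mem h]
    simp only [δ]
    rw [Finset.prod_insert hm, h1, mul_comm]
    congr 1
    refine Finset.prod_congr rfl fun k hk => ?_
    rw [Finset.filter_insert, if_neg (h k hk).not_gt]
  refine ⟨δ, fun S => ?_, fun m S => ?_⟩
  · rw [norm_prod]
    exact Finset.prod_eq_one fun m _ => hρ _ _ (by simp)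
  · induction S using Finset.induction_on_max_value f with
    | empty => exact fun hm => hmax m _ hm (by simp)
    | @insert x S hx hmx ih =>
      intro hm
      have hne : m ≠ x := fun h => hm (by simp [h])
      have hmS : m ∉ S := fun h => hm (by simp [h])
      have hlt (k) (hk : k ∈ S) : f k < f x :=
        lt_of_le_of_ne (hmx k hk) fun h => hx (f.injective h ▸ hk)
      rcases lt_or_gt_of_ne (f.injective.ne hne) with h | h
      -- Here `m` lies below the maximum `x`: insert `x` last, and exchange the two insertions by
      -- the cocycle relation.
      · rw [Finset.insert_comm, hmax x (insert m S) (by simp [hne.symm, hx]), ih hmS,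
          hmax x S hx hlt, mul_assoc, hc m x S hne hmS hx, mul_assoc]
        simp only [Finset.mem_insert]
        rintro k (rfl | hk)
        exacts [h, hlt k hk]
      · refine hmax m _ hm ?_
        simp only [Finset.mem_insert]
        rintro k (rfl | hk)
        exacts [h, (hlt k hk).trans h]

/-- An anticommuting family of lowering operators with unimodular coefficients. -/
structure IsLadder (b : M → Matrix (Finset M) (Finset M) ℂ) : Prop where
  shape : ∀ m S T, ¬ (m ∉ S ∧ T = insert m S) → b m S T = 0
  norm : ∀ m S, m ∉ S → ‖b m S (insert m S)‖ = 1
  anticomm : ∀ m n, m ≠ n → b m * b n + b n * b m = 0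

theorem IsLadder.mul_apply {b : M → Matrix (Finset M) (Finset M) ℂ} (hb : IsLadder b)
    {m n : M} {S : Finset M} (T : Finset M) :
    (b m * b n) S T = b m S (insert m S) * b n (insert m S) T := by
  rw [Matrix.mul_apply, Finset.sum_eq_single (insert m S)]
  · intro U _ hU
    rw [hb.shape m S U (fun h => hU h.2), zero_mul]
  · simp

theorem IsLadder.exchange {b : M → Matrix (Finset M) (Finset M) ℂ} (hb : IsLadder b)
    {m n : M} {S : Finset M} (hmn : m ≠ n) :
    b m S (insert m S) * b n (insert m S) (insert n (insert m S)) =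
      -(b n S (insert n S) * b m (insert n S) (insert m (insert n S))) := by
  have h := congrFun (congrFun (hb.anticomm m n hmn) S) (insert n (insert m S))
  rw [Matrix.add_apply, hb.mul_apply, hb.mul_apply, Matrix.zero_apply] at h
  rw [Finset.insert_comm m n]
  exact eq_neg_of_add_eq_zero_left h

theorem norm_jwSign {M : Type*} [Fintype M] (m : M) (S : Finset M) : ‖jwSign m S‖ = 1 := by
  simp [jwSign]

theorem isLadder_ann : IsLadder (ann : M → Matrix (Finset M) (Finset M) ℂ) where
  shape m S T h := by simp only [ann, Matrix.of_apply, if_neg h]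
  norm m S h := by simp [ann, h, norm_jwSign]
  anticomm m n _ := ann_anticomm m n

/-- Any two ladders are conjugate by a diagonal unitary matrix. -/
theorem IsLadder.exists_conj {b : M → Matrix (Finset M) (Finset M) ℂ} (hb : IsLadder b) :
    ∃ δ : Finset M → ℂ, (∀ S, ‖δ S‖ = 1) ∧
      ∀ m S T, δ S * ann m S T * star (δ T) = b m S T := by
  have hmul (z : ℂ) (hz : ‖z‖ = 1) : z * star z = 1 := by
    rw [Complex.star_def, Complex.mul_conj, Complex.normSq_eq_norm_sq, hz]; norm_num
  -- The ratio of the two families of coefficients is a cocycle, because the minus signs from the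
  -- two anticommutation relations cancel.
  obtain ⟨δ, h1, h2⟩ := exists_potential
    (fun m S => ann m S (insert m S) * star (b m S (insert m S)))
    (fun m S h => by rw [norm_mul, norm_star, isLadder_ann.norm m S h, hb.norm m S h, mul_one])
    (fun m n S hmn hm hn => by
      have e1 := isLadder_ann.exchange (S := S) hmn
      have e2 := congrArg star (hb.exchange (S := S) hmn)
      simp only [star_mul', star_neg] at e2
      rw [mul_mul_mul_comm, e1, e2, mul_mul_mul_comm]
      ring)
  refine ⟨δ, h1, fun m S T => ?_⟩
  by_cases h : m ∉ S ∧ T = insert m S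
  · obtain ⟨hm, rfl⟩ := h
    rw [h2 m S hm]
    simp only [star_mul', star_star]
    have e1 := hmul _ (h1 S)
    have e2 := hmul _ (isLadder_ann.norm m S hm)
    linear_combination (ann m S (insert m S) * star (ann m S (insert m S)) * b m S (insert m S)) * e1
      + b m S (insert m S) * e2
  · rw [hb.shape m S T h, isLadder_ann.shape m S T h]; ring

end Ladder

/-! ### Splitting the Fock space along a reflection -/

/-- A fixed-point free involution together with a choice of one half. -/
structure Reflection (M : Type*) where
  /-- The involution. -/
  r : M → M
  /-- Membership in the left half. -/
  left : M → Prop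
  decLeft : DecidablePred left
  r_r : ∀ m, r (r m) = m
  left_r : ∀ m, left (r m) ↔ ¬ left m

namespace Reflection

variable {M : Type*} (R : Reflection M)

instance : DecidablePred R.left := R.decLeft

/-- The left half. -/
abbrev Half : Type _ := {m : M // R.left m}

/-- The projection onto the left half that identifies mirror images. -/
def proj (m : M) : R.Half :=
  if h : R.left m then ⟨m, h⟩ else ⟨R.r m, (R.left_r m).2 h⟩

theorem proj_left {m : M} (h : R.left m) : R.proj m = ⟨m, h⟩ := dif_pos h

theorem proj_right {m : M} (h : ¬ R.left m) : R.proj m = ⟨R.r m, (R.left_r m).2 h⟩ := dif_neg h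

theorem proj_r (m : M) : R.proj (R.r m) = R.proj m := by
  by_cases h : R.left m
  · rw [R.proj_left h, R.proj_right (by rw [R.left_r]; exact not_not.2 h)]
    simp only [R.r_r]
  · rw [R.proj_right h, R.proj_left ((R.left_r m).2 h)]

variable [Fintype M] [DecidableEq M]

/-- A subset of all modes is given by its left part and by the complement of its right part. -/
def split : Finset M ≃ Finset R.Half × Finset R.Half where
  toFun U := (Finset.univ.filter fun k => k.1 ∈ U, Finset.univ.filter fun k => R.r k.1 ∉ U)
  invFun p := Finset.univ.filter fun m =>
    (R.left m ∧ R.proj m ∈ p.1) ∨ (¬ R.left m ∧ R.proj m ∉ p.2)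
  left_inv U := by
    ext m
    by_cases h : R.left m
    · simp [h, R.proj_left h]
    · simp [h, R.proj_right h, R.r_r]
  right_inv p := by
    ext k
    · simp [k.2, R.proj_left k.2]
    · simp [R.left_r, k.2, R.proj_r, R.proj_left k.2]

theorem mem_split_fst (k : R.Half) (U : Finset M) : k ∈ (R.split U).1 ↔ k.1 ∈ U := by
  simp [split]

theorem mem_split_snd (k : R.Half) (U : Finset M) : k ∈ (R.split U).2 ↔ R.r k.1 ∉ U := by
  simp [split]

theorem split_insert_left {m : M} (h : R.left m) (U : Finset M) :
    R.split (insert m U) = (insert (R.proj m) (R.split U).1, (R.split U).2) := by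
  refine Prod.ext (Finset.ext fun k => ?_) (Finset.ext fun k => ?_)
  · simp only [mem_split_fst, Finset.mem_insert, R.proj_left h, Subtype.ext_iff]
  · have : R.r k.1 ≠ m := fun e => (R.left_r k.1).1 (e ▸ h) k.2
    simp [mem_split_snd, this]

theorem split_insert_right {m : M} (h : ¬ R.left m) (U : Finset M) :
    R.split (insert m U) = ((R.split U).1, (R.split U).2.erase (R.proj m)) := by
  refine Prod.ext (Finset.ext fun k => ?_) (Finset.ext fun k => ?_)
  · have : k.1 ≠ m := fun e => h (e ▸ k.2)
    simp [mem_split_fst, this]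
  · have : R.r k.1 = m ↔ k.1 = R.r m := ⟨fun e => by rw [← e, R.r_r], fun e => by rw [e, R.r_r]⟩
    simp [mem_split_snd, R.proj_right h, Subtype.ext_iff, this]

end Reflection

/-! ### Fermion parity, and the reality of the fermion operators. -/

section Parity

variable {N : Type*} [Fintype N] [DecidableEq N]

/-- The fermion parity `(-1)^N`. -/
def parity (N : Type*) [Fintype N] [DecidableEq N] : Matrix (Finset N) (Finset N) ℂ :=
  Matrix.diagonal fun S => (-1) ^ S.card

theorem parity_mul_parity : parity N * parity N = 1 := by
  rw [parity, Matrix.diagonal_mul_diagonal]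
  simp [← mul_pow]

theorem parity_conjTranspose : (parity N)ᴴ = parity N := by
  rw [parity, Matrix.diagonal_conjTranspose]
  congr 1; ext S; simp

theorem parity_mul_ann (m : N) : parity N * ann m = -(ann m * parity N) := by
  ext S T
  rw [parity, Matrix.diagonal_mul, Matrix.neg_apply, Matrix.mul_diagonal]
  by_cases h : m ∉ S ∧ T = insert m S
  · obtain ⟨h, rfl⟩ := h
    rw [Finset.card_insert_of_notMem h]; ring
  · rw [isLadder_ann.shape m S T h]; ring

theorem parity_mul_cre (m : N) : parity N * cre m = -(cre m * parity N) := by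
  have h := congrArg Matrix.conjTranspose (parity_mul_ann m)
  rw [Matrix.conjTranspose_neg, Matrix.conjTranspose_mul, Matrix.conjTranspose_mul,
    parity_conjTranspose] at h
  rw [cre, h, neg_neg]

theorem conjMat_parity : conjMat (parity N) = parity N := by
  ext S T
  simp [parity, Matrix.diagonal_apply, apply_ite (starRingEnd ℂ)]

theorem conjMat_ann (m : N) : conjMat (ann m) = ann m := by
  ext S T
  simp [ann, apply_ite (starRingEnd ℂ), jwSign]

theorem conjMat_cre (m : N) : conjMat (cre m) = cre m := by
  ext S T
  have := congrFun (congrFun (conjMat_ann m) T) S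
  simpa [cre] using this.symm

theorem cre_anticomm (m n : N) : cre m * cre n + cre n * cre m = 0 := by
  have h := congrArg Matrix.conjTranspose (ann_anticomm n m)
  rwa [Matrix.conjTranspose_add, Matrix.conjTranspose_mul, Matrix.conjTranspose_mul,
    Matrix.conjTranspose_zero] at h

end Parity

/-! ### Particle-hole representation on the tensor square. -/

namespace Reflection

variable {M : Type*} (R : Reflection M) [Fintype M] [DecidableEq M]

/-- The annihilation operators in the split Fock space: the modes on the right are subjected to a
particle-hole transformation and multiplied by phases. -/
noncomputable def splitAnn (ω : M → ℂ) (m : M) :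
    Matrix (Finset R.Half × Finset R.Half) (Finset R.Half × Finset R.Half) ℂ :=
  if R.left m then ann (R.proj m) ⊗ₖ 1
  else ω m • (parity R.Half ⊗ₖ (parity R.Half * cre (R.proj m)))

theorem splitAnn_left (ω : M → ℂ) {m : M} (h : R.left m) :
    R.splitAnn ω m = ann (R.proj m) ⊗ₖ 1 := if_pos h

theorem splitAnn_right (ω : M → ℂ) {m : M} (h : ¬ R.left m) :
    R.splitAnn ω m = ω m • (parity R.Half ⊗ₖ (parity R.Half * cre (R.proj m))) := if_neg h

/-- The parity in the first tensor factor makes a right operator anticommute with the left ones.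
Between two right operators it squares to `1`, and the anticommutation of the creation operators in
the second factor remains. -/
theorem splitAnn_anticomm (ω : M → ℂ) (m n : M) :
    R.splitAnn ω m * R.splitAnn ω n + R.splitAnn ω n * R.splitAnn ω m = 0 := by
  have mixed (m n) (hm : R.left m) (hn : ¬ R.left n) :
      R.splitAnn ω m * R.splitAnn ω n + R.splitAnn ω n * R.splitAnn ω m = 0 := by
    rw [R.splitAnn_left ω hm, R.splitAnn_right ω hn, Matrix.mul_smul, Matrix.smul_mul,
      ← Matrix.mul_kronecker_mul, ← Matrix.mul_kronecker_mul, one_mul, mul_one, ← smul_add,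
      ← Matrix.add_kronecker, parity_mul_ann, add_neg_cancel, Matrix.zero_kronecker, smul_zero]
  by_cases hm : R.left m <;> by_cases hn : R.left n
  · rw [R.splitAnn_left ω hm, R.splitAnn_left ω hn, ← Matrix.mul_kronecker_mul,
      ← Matrix.mul_kronecker_mul, ← Matrix.add_kronecker, ann_anticomm, Matrix.zero_kronecker]
  · exact mixed m n hm hn
  · rw [add_comm]; exact mixed n m hn hm
  · have e (j k : R.Half) : parity R.Half * cre j * (parity R.Half * cre k) = -(cre j * cre k) := by
      rw [parity_mul_cre, neg_mul, mul_assoc, ← mul_assoc (parity R.Half), parity_mul_parity, one_mul]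
    rw [R.splitAnn_right ω hm, R.splitAnn_right ω hn]
    simp only [Matrix.mul_smul, Matrix.smul_mul, smul_smul, ← Matrix.mul_kronecker_mul, e]
    rw [mul_comm (ω n), ← smul_add, ← Matrix.kronecker_add, ← neg_add, cre_anticomm, neg_zero,
      Matrix.kronecker_zero, smul_zero]

/-- The second component of `split` records holes, so creating there amounts to annihilating a mode
on the right. -/
theorem isLadder_splitAnn {ω : M → ℂ} (hω : ∀ m, ‖ω m‖ = 1) :
    IsLadder fun m => (R.splitAnn ω m).submatrix R.split R.split where
  shape m U V h := by
    contrapose! h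
    rw [Matrix.submatrix_apply] at h
    by_cases hm : R.left m
    · rw [R.splitAnn_left ω hm, Matrix.kronecker_apply, Matrix.one_apply] at h
      have h1 := left_ne_zero_of_mul h
      have h2 := right_ne_zero_of_mul h
      have h3 : R.proj m ∉ (R.split U).1 ∧ (R.split V).1 = insert (R.proj m) (R.split U).1 := by
        by_contra hc; exact h1 (isLadder_ann.shape _ _ _ hc)
      have h4 : (R.split U).2 = (R.split V).2 := by by_contra hc; simp [hc] at h2
      refine ⟨by simpa [mem_split_fst, R.proj_left hm] using h3.1, R.split.injective ?_⟩
      rw [R.split_insert_left hm]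
      exact Prod.ext h3.2 h4.symm
    · rw [R.splitAnn_right ω hm, Matrix.smul_apply, Matrix.kronecker_apply, parity,
        Matrix.diagonal_mul] at h
      have h0 := right_ne_zero_of_mul h
      have h1 := left_ne_zero_of_mul h0
      have h2 := right_ne_zero_of_mul (right_ne_zero_of_mul h0)
      rw [cre, Matrix.conjTranspose_apply] at h2
      have h3 : R.proj m ∉ (R.split V).2 ∧ (R.split U).2 = insert (R.proj m) (R.split V).2 := by
        by_contra hc; exact h2 (by rw [isLadder_ann.shape _ _ _ hc, star_zero])
      have h4 : (R.split U).1 = (R.split V).1 := by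
        by_contra hc; exact h1 (Matrix.diagonal_apply_ne _ hc)
      have h5 : R.proj m ∈ (R.split U).2 := by rw [h3.2]; exact Finset.mem_insert_self _ _
      refine ⟨by simpa [mem_split_snd, R.proj_right hm, R.r_r] using h5, R.split.injective ?_⟩
      rw [R.split_insert_right hm]
      refine Prod.ext h4.symm ?_
      rw [h3.2, Finset.erase_insert h3.1]
  norm m U h := by
    rw [Matrix.submatrix_apply]
    by_cases hm : R.left m
    · rw [R.split_insert_left hm, R.splitAnn_left ω hm, Matrix.kronecker_apply, Matrix.one_apply_eq,
        mul_one]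
      exact isLadder_ann.norm _ _ (by simpa [mem_split_fst, R.proj_left hm] using h)
    · have hk : R.proj m ∈ (R.split U).2 := by simpa [mem_split_snd, R.proj_right hm, R.r_r] using h
      have hn := isLadder_ann.norm (R.proj m) ((R.split U).2.erase (R.proj m)) (by simp)
      rw [Finset.insert_erase hk] at hn
      rw [R.split_insert_right hm, R.splitAnn_right ω hm, Matrix.smul_apply, Matrix.kronecker_apply,
        parity, Matrix.diagonal_mul, Matrix.diagonal_apply_eq, cre, Matrix.conjTranspose_apply]
      simp [hω, hn]
  anticomm m n _ := by
    rw [Matrix.submatrix_mul_equiv, Matrix.submatrix_mul_equiv]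
    exact congrArg (fun A => A.submatrix R.split R.split) (R.splitAnn_anticomm ω m n)

/-- The Fock space over all modes is the tensor square of the Fock space over the left half, by a
unitary map that takes the annihilation operators to the operators `splitAnn`. -/
theorem exists_starAlgHom_splitAnn {ω : M → ℂ} (hω : ∀ m, ‖ω m‖ = 1) :
    ∃ Φ : Matrix (Finset M) (Finset M) ℂ →⋆ₐ[ℂ]
        Matrix (Finset R.Half × Finset R.Half) (Finset R.Half × Finset R.Half) ℂ,
      (∀ X, (Φ X).trace = X.trace) ∧ ∀ m, Φ (ann m) = R.splitAnn ω m := by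
  obtain ⟨δ, h1, h2⟩ := (R.isLadder_splitAnn hω).exists_conj
  have hδ (S) : δ S * star (δ S) = 1 := by
    rw [Complex.star_def, Complex.mul_conj, Complex.normSq_eq_norm_sq, h1]; norm_num
  let φ := R.split.symm
  have hmul (X Y : Matrix (Finset M) (Finset M) ℂ) (p q) :
      δ (φ p) * (X * Y) (φ p) (φ q) * star (δ (φ q)) =
      ∑ k, δ (φ p) * X (φ p) (φ k) * star (δ (φ k)) * (δ (φ k) * Y (φ k) (φ q) * star (δ (φ q))) := by
    rw [Matrix.mul_apply, Finset.mul_sum, Finset.sum_mul, ← φ.sum_comp]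
    refine Finset.sum_congr rfl fun k _ => ?_
    linear_combination (-(δ (φ p) * X (φ p) (φ k) * Y (φ k) (φ q) * star (δ (φ q)))) * hδ (φ k)
  have hone (p q) : δ (φ p) * (1 : Matrix (Finset M) (Finset M) ℂ) (φ p) (φ q) * star (δ (φ q)) =
      (1 : Matrix (Finset R.Half × Finset R.Half) (Finset R.Half × Finset R.Half) ℂ) p q := by
    by_cases h : p = q
    · subst h; rw [Matrix.one_apply_eq, Matrix.one_apply_eq, mul_one, hδ]
    · rw [Matrix.one_apply_ne h, Matrix.one_apply_ne (φ.injective.ne h)]; ring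
  refine ⟨{ toFun := fun X => Matrix.of fun p q => δ (φ p) * X (φ p) (φ q) * star (δ (φ q))
            map_one' := by ext p q; exact hone p q
            map_mul' := fun X Y => by ext p q; rw [Matrix.of_apply, hmul, Matrix.mul_apply]; rfl
            map_zero' := by ext p q; simp
            map_add' := fun X Y => by ext p q; simp [mul_add, add_mul]
            commutes' := fun c => by
              ext p q
              rw [Algebra.algebraMap_eq_smul_one, Algebra.algebraMap_eq_smul_one, Matrix.smul_apply,
                ← hone, Matrix.of_apply, Matrix.smul_apply, smul_eq_mul, smul_eq_mul]
              ring
            map_star' := fun X => by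
              ext p q
              simp only [Matrix.star_eq_conjTranspose, Matrix.conjTranspose_apply, Matrix.of_apply,
                star_mul', star_star]
              ring }, fun X => ?_, fun m => ?_⟩
  · change ∑ p, δ (φ p) * X (φ p) (φ p) * star (δ (φ p)) = ∑ S, X S S
    rw [← φ.sum_comp]
    refine Finset.sum_congr rfl fun p _ => ?_
    linear_combination X (φ p) (φ p) * hδ (φ p)
  · ext p q
    have := h2 m (φ p) (φ q)
    simpa [φ] using this

end Reflection

end PiFlux

namespace PiFlux

open scoped Kronecker
open NormedSpace Filter Topology

/-! ### The Hamiltonian as a sum over bonds -/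

section BondTerm

variable {n m : Type*} [Fintype n] [Fintype m] [DecidableEq m]

/-- The hopping and pairing terms of a bond with hopping phase `w`, between sites with annihilation
operators `A` and `B`. -/
noncomputable def bondTerm (κ g : ℝ) (A B : Spin → Matrix n n ℂ) (w : ℂ) : Matrix n n ℂ :=
  (κ : ℂ) • ∑ σ, (w • ((A σ)ᴴ * B σ) + star w • ((B σ)ᴴ * A σ))
    - (g : ℂ) • (w ^ 2 • ((A up)ᴴ * (A down)ᴴ * B down * B up)
      + star w ^ 2 • ((B up)ᴴ * (B down)ᴴ * A down * A up))

theorem bondTerm_comm (κ g : ℝ) (A B : Spin → Matrix n n ℂ) (w : ℂ) :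
    bondTerm κ g A B w = bondTerm κ g B A (star w) := by
  simp only [bondTerm, star_star]
  rw [add_comm (w ^ 2 • _)]
  simp only [add_comm (w • _)]

theorem isHermitian_bondTerm (κ g : ℝ) (A B : Spin → Matrix n n ℂ) (w : ℂ) :
    (bondTerm κ g A B w).IsHermitian := by
  have hr (c : ℝ) : star (c : ℂ) = c := Complex.conj_ofReal c
  unfold bondTerm Matrix.IsHermitian
  simp only [Matrix.conjTranspose_sub, Matrix.conjTranspose_smul, Matrix.conjTranspose_sum,
    Matrix.conjTranspose_add, Matrix.conjTranspose_mul, Matrix.conjTranspose_conjTranspose,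
    star_pow, star_star, hr, ← mul_assoc]
  rw [add_comm (star w ^ 2 • _)]
  simp only [add_comm (star w • _)]

theorem map_bondTerm [DecidableEq n] (Φ : Matrix n n ℂ →⋆ₐ[ℂ] Matrix m m ℂ) (κ g : ℝ)
    (A B : Spin → Matrix n n ℂ) (w : ℂ) :
    Φ (bondTerm κ g A B w) = bondTerm κ g (fun σ => Φ (A σ)) (fun σ => Φ (B σ)) w := by
  simp only [bondTerm, map_sub, map_smul, map_sum, map_add, map_mul,
    ← Matrix.star_eq_conjTranspose, map_star]

/-- In the occupation basis `ann` and `cre` are real, so complex conjugation only affects the phase.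
-/
theorem conjMat_bondTerm_ann (κ g : ℝ) (a b : Spin → m) (w : ℂ) :
    conjMat (bondTerm κ g (fun σ => ann (a σ)) (fun σ => ann (b σ)) w) =
      bondTerm κ g (fun σ => ann (a σ)) (fun σ => ann (b σ)) (star w) := by
  have hr (c : ℝ) : star (c : ℂ) = c := Complex.conj_ofReal c
  have hc (k : m) : (ann k)ᴴ = cre k := rfl
  simp only [bondTerm, map_sub, map_sum, map_add, conjMat_smul, map_mul, hc, conjMat_ann,
    conjMat_cre, hr, star_pow]

theorem bondTerm_kronecker_one (κ g : ℝ) (A B : Spin → Matrix n n ℂ) (w : ℂ) :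
    bondTerm κ g (fun σ => A σ ⊗ₖ (1 : Matrix m m ℂ)) (fun σ => B σ ⊗ₖ (1 : Matrix m m ℂ)) w =
      bondTerm κ g A B w ⊗ₖ (1 : Matrix m m ℂ) := by
  have sub_kronecker (X Y : Matrix n n ℂ) :
      (X - Y) ⊗ₖ (1 : Matrix m m ℂ) = X ⊗ₖ (1 : Matrix m m ℂ) - Y ⊗ₖ (1 : Matrix m m ℂ) := by
    ext ⟨i, i'⟩ ⟨j, j'⟩; simp [sub_mul]
  simp only [bondTerm, Matrix.conjTranspose_kronecker, Matrix.conjTranspose_one,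
    ← Matrix.mul_kronecker_mul, mul_one, ← Matrix.smul_kronecker, ← Matrix.add_kronecker,
    Fintype.sum_bool, sub_kronecker]

theorem ann_mul_cre_of_ne {a b : m} (h : a ≠ b) : ann a * cre b = -(cre b * ann a) := by
  have := ann_cre_anticomm a b
  rw [if_neg h] at this
  exact eq_neg_of_add_eq_zero_left this

theorem ann_mul_ann_comm (a b : m) : ann a * ann b = -(ann b * ann a) :=
  eq_neg_of_add_eq_zero_left (ann_anticomm a b)

theorem cre_mul_cre_comm (a b : m) : cre a * cre b = -(cre b * cre a) :=
  eq_neg_of_add_eq_zero_left (cre_anticomm a b)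

theorem cre_conjTranspose (a : m) : (cre a)ᴴ = ann a := Matrix.conjTranspose_conjTranspose _

/-- Moving two operators past two others costs four signs, and reversing the order inside each pair
costs two more; none survives. -/
theorem pair_reorder {a b : Spin → m} (h : ∀ σ τ, a σ ≠ b τ) :
    ann (a up) * (ann (a down) * (cre (b down) * cre (b up))) =
      cre (b up) * (cre (b down) * (ann (a down) * ann (a up))) := by
  have e (σ τ) (X : Matrix (Finset m) (Finset m) ℂ) :
      ann (a σ) * (cre (b τ) * X) = -(cre (b τ) * (ann (a σ) * X)) := by
    rw [← mul_assoc, ann_mul_cre_of_ne (h σ τ), neg_mul, mul_assoc]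
  rw [e, ann_mul_cre_of_ne (h _ _)]
  simp only [mul_neg, neg_neg, e]
  rw [ann_mul_ann_comm (a up), mul_neg, mul_neg, ← mul_assoc, cre_mul_cre_comm (b down), neg_mul,
    neg_neg, mul_assoc]

/-- A bond on the right, after the particle-hole transformation. -/
theorem bondTerm_right (κ g : ℝ) {a b : Spin → m} (h : ∀ σ τ, a σ ≠ b τ) (ω₁ ω₂ w : ℂ) :
    bondTerm κ g (fun σ => ω₁ • (parity m ⊗ₖ (parity m * cre (a σ))))
        (fun σ => ω₂ • (parity m ⊗ₖ (parity m * cre (b σ)))) w =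
      (1 : Matrix (Finset m) (Finset m) ℂ) ⊗ₖ
        bondTerm κ g (fun σ => ann (a σ)) (fun σ => ann (b σ)) (-(star w * ω₁ * star ω₂)) := by
  have hh σ τ := (h τ σ).symm
  have p1 (k : m) (X : Matrix (Finset m) (Finset m) ℂ) :
      parity m * (ann k * X) = -(ann k * (parity m * X)) := by
    rw [← mul_assoc, parity_mul_ann, neg_mul, mul_assoc]
  have p2 (k : m) (X : Matrix (Finset m) (Finset m) ℂ) :
      parity m * (cre k * X) = -(cre k * (parity m * X)) := by
    rw [← mul_assoc, parity_mul_cre, neg_mul, mul_assoc]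
  have hc (k : m) : (ann k)ᴴ = cre k := rfl
  -- Hopping becomes `ann * cre`; normal ordering it reverses its direction, which conjugates the
  -- phase, and produces the minus sign. The pairing is also reversed but acquires no sign,
  -- consistently with its dependence on the square of the phase.
  simp only [bondTerm, Matrix.conjTranspose_smul, Matrix.conjTranspose_kronecker,
    Matrix.conjTranspose_mul, parity_conjTranspose, cre_conjTranspose, hc, Matrix.smul_mul,
    Matrix.mul_smul, ← Matrix.mul_kronecker_mul, smul_smul, parity_mul_parity, mul_assoc,
    one_mul, mul_one, p1, p2, parity_mul_ann,
    parity_mul_cre, Matrix.conjTranspose_neg, mul_neg, neg_mul, neg_neg, pair_reorder h, pair_reorder hh,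
    ann_mul_cre_of_ne (h _ _), ann_mul_cre_of_ne (hh _ _), Fintype.sum_bool,
    Matrix.kronecker_add, Matrix.kronecker_smul, sub_eq_add_neg, ← neg_smul, star_neg, star_mul', star_star, neg_sq]
  simp only [smul_neg, ← neg_smul, ← Matrix.kronecker_smul, ← Matrix.kronecker_add]
  congr 1
  module

/-- The operators on one side of a reflection plane that a bond across the plane couples. -/
noncomputable def crossOp (β κ g : ℝ) (a : Spin → m) :
    Option Spin × Bool → Matrix (Finset m) (Finset m) ℂ
  | (some σ, true) => ((Real.sqrt (β * |κ|) : ℝ) : ℂ) • (cre (a σ) * parity m)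
  | (some σ, false) => ((Real.sqrt (β * |κ|) : ℝ) : ℂ) • (ann (a σ) * parity m)
  | (none, true) => ((Real.sqrt (β * g) : ℝ) : ℂ) • (cre (a up) * cre (a down))
  | (none, false) => ((Real.sqrt (β * g) : ℝ) : ℂ) • (ann (a down) * ann (a up))

/-- The phases of the couplings across a reflection plane. -/
noncomputable def crossPhase (u : ℂ) : Option Spin × Bool → ℂ
  | (some _, true) => u
  | (some _, false) => star u
  | (none, true) => u ^ 2
  | (none, false) => star u ^ 2

theorem crossPhase_one (k : Option Spin × Bool) : crossPhase 1 k = 1 := by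
  rcases k with ⟨_ | σ, _ | _⟩ <;> simp [crossPhase]

theorem norm_crossPhase {u : ℂ} (hu : ‖u‖ = 1) (k : Option Spin × Bool) : ‖crossPhase u k‖ = 1 := by
  rcases k with ⟨_ | σ, _ | _⟩ <;> simp [crossPhase, hu]

theorem conjMat_crossOp (β κ g : ℝ) (a : Spin → m) (k : Option Spin × Bool) :
    conjMat (crossOp β κ g a k) = crossOp β κ g a k := by
  have hr (c : ℝ) : star (c : ℂ) = c := Complex.conj_ofReal c
  rcases k with ⟨_ | σ, _ | _⟩ <;>
    simp only [crossOp, conjMat_smul, map_mul, conjMat_ann, conjMat_cre, conjMat_parity, hr]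

/-- A bond across the reflection plane. -/
theorem bondTerm_cross {β κ g : ℝ} (hβ : 0 ≤ β) (hg : 0 ≤ g) (a : Spin → m) {s : ℝ}
    (hs : s ^ 2 = 1) (hsκ : s * κ = |κ|) {ω w u : ℂ} (hu : w * ω = s * u) :
    (-(β : ℂ)) • bondTerm κ g (fun σ => ann (a σ) ⊗ₖ (1 : Matrix (Finset m) (Finset m) ℂ))
        (fun σ => ω • (parity m ⊗ₖ (parity m * cre (a σ)))) w =
      ∑ k, crossPhase u k • (crossOp β κ g a k ⊗ₖ crossOp β κ g a k) := by
  have q1 : ((Real.sqrt (β * |κ|) : ℝ) : ℂ) * ((Real.sqrt (β * |κ|) : ℝ) : ℂ) = β * (s * κ) := by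
    rw [← Complex.ofReal_mul, Real.mul_self_sqrt (by positivity), ← hsκ]; push_cast; ring
  have q2 : ((Real.sqrt (β * g) : ℝ) : ℂ) * ((Real.sqrt (β * g) : ℝ) : ℂ) = β * g := by
    rw [← Complex.ofReal_mul, Real.mul_self_sqrt (by positivity)]; push_cast; ring
  have hs' : (s : ℂ) ^ 2 = 1 := by exact_mod_cast hs
  have hu' : star w * star ω = s * star u := by
    rw [← star_mul', hu, star_mul']; congr 1; exact Complex.conj_ofReal s
  have hc (k : m) : (ann k)ᴴ = cre k := rfl
  have p1 (k : m) (X : Matrix (Finset m) (Finset m) ℂ) :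
      parity m * (ann k * X) = -(ann k * (parity m * X)) := by
    rw [← mul_assoc, parity_mul_ann, neg_mul, mul_assoc]
  have p2 (k : m) (X : Matrix (Finset m) (Finset m) ℂ) :
      parity m * (cre k * X) = -(cre k * (parity m * X)) := by
    rw [← mul_assoc, parity_mul_cre, neg_mul, mul_assoc]
  have c1 : cre (a down) * cre (a up) = -(cre (a up) * cre (a down)) := cre_mul_cre_comm _ _
  have c2 : ann (a up) * ann (a down) = -(ann (a down) * ann (a up)) := ann_mul_ann_comm _ _
  -- Moving the parity to the right in one tensor factor gives hopping a sign that cancels the one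
  -- in `-β`. In the pairing the reordering signs cancel each other, and `-β` meets the `-g` of
  -- `bondTerm`. Hence the coefficients are `β|κ|` and `βg`, up to the phases.
  simp only [Fintype.sum_prod_type, Fintype.sum_option, Fintype.sum_bool, crossOp, crossPhase,
    Matrix.smul_kronecker, Matrix.kronecker_smul, smul_smul, q1, q2]
  simp only [bondTerm, Matrix.conjTranspose_smul, Matrix.conjTranspose_kronecker,
    Matrix.conjTranspose_mul, Matrix.conjTranspose_one, parity_conjTranspose, cre_conjTranspose, hc,
    Matrix.smul_mul, Matrix.conjTranspose_neg, Matrix.mul_smul, ← Matrix.mul_kronecker_mul, smul_smul, mul_assoc,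
    parity_mul_parity, parity_mul_ann, parity_mul_cre, p1, p2, one_mul, mul_one,
    mul_neg, neg_mul, neg_neg, c1, c2, Fintype.sum_bool]
  have kn (X Y : Matrix (Finset m) (Finset m) ℂ) : X ⊗ₖ (-Y) = -(X ⊗ₖ Y) := by
    ext i j; simp
  have nk (X Y : Matrix (Finset m) (Finset m) ℂ) : (-X) ⊗ₖ Y = -(X ⊗ₖ Y) := by
    ext i j; simp
  simp only [kn, nk]
  -- The pairing is quadratic in the phase, so the sign `s` chosen for the hopping drops out.
  have h1 : w ^ 2 * (ω * ω) = u ^ 2 := by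
    linear_combination (w * ω + s * u) * hu + u ^ 2 * hs'
  have h2 : star w ^ 2 * (star ω * star ω) = star u ^ 2 := by
    linear_combination (star w * star ω + s * star u) * hu' + star u ^ 2 * hs'
  rw [hu, hu', h1, h2]
  module

end BondTerm

end PiFlux

namespace PiFlux

open scoped Kronecker
open NormedSpace Filter Topology

theorem map_matrix_exp {n m : Type*} [Fintype n] [DecidableEq n] [Fintype m] [DecidableEq m]
    (Φ : Matrix n n ℂ →⋆ₐ[ℂ] Matrix m m ℂ) (Y : Matrix n n ℂ) : Φ (exp Y) = exp (Φ Y) := by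
  let _ : NormedRing (Matrix n n ℂ) := Matrix.linftyOpNormedRing
  let _ : NormedAlgebra ℂ (Matrix n n ℂ) := Matrix.linftyOpNormedAlgebra
  let _ : NormedAlgebra ℚ (Matrix n n ℂ) := .restrictScalars ℚ ℂ _
  let _ : NormedRing (Matrix m m ℂ) := Matrix.linftyOpNormedRing
  have h : CompleteSpace (Matrix n n ℂ) := inferInstance
  have hΦ : Continuous Φ := LinearMap.continuous_of_finiteDimensional Φ.toAlgHom.toLinearMap
  exact @map_exp (Matrix n n ℂ) (Matrix m m ℂ) _ _ h _ _ _ _ _ Φ hΦ Y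

/-! ### Reflection positivity for sums over bonds -/

section BondReflection

variable {X B : Type*}

/-- The reflection of the modes `(x, σ)` induced by a reflection of the sites. -/
def Reflection.spin (R : Reflection X) : Reflection (X × Spin) where
  r p := (R.r p.1, p.2)
  left p := R.left p.1
  decLeft p := R.decLeft p.1
  r_r p := by simp [R.r_r]
  left_r p := R.left_r p.1

/-- The mode of the left half that corresponds to `(x, σ)`. -/
abbrev Reflection.halfMode (R : Reflection X) (x : X) (σ : Spin) : R.spin.Half :=
  R.spin.proj (x, σ)

theorem Reflection.halfMode_r (R : Reflection X) (x : X) : R.halfMode (R.r x) = R.halfMode x :=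
  funext fun σ => R.spin.proj_r (x, σ)

theorem Reflection.halfMode_ne (R : Reflection X) {x y : X} (hxy : x ≠ y)
    (h : R.left x ↔ R.left y) (σ τ : Spin) : R.halfMode x σ ≠ R.halfMode y τ := by
  intro e
  by_cases hx : R.left x
  · rw [halfMode, halfMode, R.spin.proj_left (m := (x, σ)) hx,
      R.spin.proj_left (m := (y, τ)) (h.1 hx)] at e
    exact hxy (congrArg (fun p => p.1.1) e)
  · rw [halfMode, halfMode, R.spin.proj_right (m := (x, σ)) hx,
      R.spin.proj_right (m := (y, τ)) (fun c => hx (h.2 c))] at e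
    have e1 : R.r x = R.r y := congrArg (fun p => p.1.1) e
    exact hxy (by rw [← R.r_r x, e1, R.r_r])

/-- The hopping phases `w₀` on bonds `src b → tgt b` are compatible with the reflection `R`: after
a gauge transformation by `ω` on the right, `w₀` is reflection symmetric up to the sign produced by
the particle-hole transformation, and the bonds that cross join mirror images, with coupling of the
sign that makes the reflection positive. -/
structure BondMirror (R : Reflection X) (src tgt : B → X) (w₀ : B → ℂ) (κ : ℝ) where
  /-- The gauge transformation. -/
  ω : X → ℂ
  norm_ω : ∀ x, ‖ω x‖ = 1
  /-- The sign of the hopping constant. -/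
  sgn : ℝ
  sgn_sq : sgn ^ 2 = 1
  sgn_mul : sgn * κ = |κ|
  /-- The mirror image of a bond. -/
  ρ : B → B
  ρ_ρ : ∀ b, ρ (ρ b) = b
  /-- Whether the reflection reverses the orientation of the bond. -/
  flip : B → Bool
  flip_ρ : ∀ b, flip (ρ b) = flip b
  src_ρ : ∀ b, src (ρ b) = R.r (if flip b then tgt b else src b)
  tgt_ρ : ∀ b, tgt (ρ b) = R.r (if flip b then src b else tgt b)
  right : ∀ b, ¬ R.left (src b) → ¬ R.left (tgt b) →
    w₀ b = -((if flip b then star (w₀ (ρ b)) else w₀ (ρ b)) * ω (src b) * star (ω (tgt b)))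
  cross : ∀ b, R.left (src b) → ¬ R.left (tgt b) →
    tgt b = R.r (src b) ∧ w₀ b * ω (tgt b) = sgn
  cross' : ∀ b, ¬ R.left (src b) → R.left (tgt b) →
    src b = R.r (tgt b) ∧ star (w₀ b) * ω (src b) = sgn

/-- The hopping phases `w₀` twisted by the gauge field `a`. -/
noncomputable def twist (w₀ : B → ℂ) (a : B → ℝ) (b : B) : ℂ :=
  w₀ b * Complex.exp (Complex.I * (a b : ℂ))

theorem star_exp_I_mul (x : ℝ) :
    star (Complex.exp (Complex.I * (x : ℂ))) = Complex.exp (Complex.I * ((-x : ℝ) : ℂ)) := by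
  rw [Complex.star_def, ← Complex.exp_conj]
  simp

theorem norm_exp_I_mul (x : ℝ) : ‖Complex.exp (Complex.I * (x : ℂ))‖ = 1 := by
  rw [mul_comm]; exact Complex.norm_exp_ofReal_mul_I x

namespace BondMirror

variable {R : Reflection X} {src tgt : B → X} {w₀ : B → ℂ} {κ : ℝ} (D : BondMirror R src tgt w₀ κ)

theorem omega_mul_star (x : X) : D.ω x * star (D.ω x) = 1 := by
  rw [Complex.star_def, Complex.mul_conj, Complex.normSq_eq_norm_sq, D.norm_ω]; norm_num

/-- The mirror image of a gauge field. -/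
def mirror (a : B → ℝ) (b : B) : ℝ := if D.flip b then -a (D.ρ b) else a (D.ρ b)

theorem mirror_mirror (a : B → ℝ) : D.mirror (D.mirror a) = a := by
  funext b
  by_cases h : D.flip b = true <;> simp [mirror, h, D.flip_ρ, D.ρ_ρ]

theorem mirror_ρ (a : B → ℝ) (b : B) :
    D.mirror a (D.ρ b) = if D.flip b then -a b else a b := by
  simp [mirror, D.flip_ρ, D.ρ_ρ]

/-- The gauge field that agrees with `a` on the left, is its mirror image on the right, and vanishes
on the bonds that cross. -/
def fold (a : B → ℝ) (b : B) : ℝ :=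
  if R.left (src b) ∧ R.left (tgt b) then a b
  else if ¬ R.left (src b) ∧ ¬ R.left (tgt b) then D.mirror a b
  else 0

theorem left_ρ (b : B) : (R.left (src (D.ρ b)) ∧ R.left (tgt (D.ρ b))) ↔
    (¬ R.left (src b) ∧ ¬ R.left (tgt b)) := by
  rw [D.src_ρ, D.tgt_ρ, R.left_r, R.left_r]
  split_ifs <;> tauto

theorem right_ρ (b : B) : (¬ R.left (src (D.ρ b)) ∧ ¬ R.left (tgt (D.ρ b))) ↔
    (R.left (src b) ∧ R.left (tgt b)) := by
  rw [← D.left_ρ, D.ρ_ρ]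

theorem fold_left (a : B → ℝ) {b : B} (h : R.left (src b) ∧ R.left (tgt b)) :
    D.fold a b = a b := if_pos h

/-- The folded field is symmetric: read off on the left, its right half is again `a`. -/
theorem mirror_fold_left (a : B → ℝ) {b : B} (h : R.left (src b) ∧ R.left (tgt b)) :
    D.mirror (D.fold a) b = a b := by
  have h1 := (D.right_ρ b).2 h
  have h2 : ¬ (R.left (src (D.ρ b)) ∧ R.left (tgt (D.ρ b))) := fun c => h1.1 c.1
  have h3 : D.fold a (D.ρ b) = D.mirror a (D.ρ b) := by rw [fold, if_neg h2, if_pos h1]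
  rw [mirror, h3, mirror_ρ]
  split_ifs <;> simp

theorem fold_cross (a : B → ℝ) {b : B} (h : ¬ (R.left (src b) ↔ R.left (tgt b))) :
    D.fold a b = 0 := by
  rw [fold, if_neg (by tauto), if_neg (by tauto)]

/-- The phase of a bond that crosses, from the left to the right. -/
noncomputable def crossAngle (R : Reflection X) (src : B → X) (a : B → ℝ)
    (p : B × (Option Spin × Bool)) : ℂ :=
  crossPhase (Complex.exp (Complex.I * ((if R.left (src p.1) then a p.1 else -a p.1 : ℝ) : ℂ))) p.2

theorem norm_crossAngle (a : B → ℝ) (p : B × (Option Spin × Bool)) :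
    ‖crossAngle R src a p‖ = 1 :=
  norm_crossPhase (norm_exp_I_mul _) _

end BondMirror

/-! ### The bond Hamiltonian and its reflection positivity. -/

variable [Fintype X] [DecidableEq X]

/-- The Hamiltonian with hopping phases `w` on the bonds `src b → tgt b`. -/
noncomputable def bondHam [Fintype B] (κ g : ℝ) (src tgt : B → X) (w : B → ℂ) :
    Matrix (Finset (X × Spin)) (Finset (X × Spin)) ℂ :=
  ∑ b, bondTerm κ g (fun σ => ann (src b, σ)) (fun σ => ann (tgt b, σ)) (w b)

/-- The partition function of `bondHam`. -/
noncomputable def bondZ [Fintype B] (β κ g : ℝ) (src tgt : B → X) (w : B → ℂ) : ℂ :=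
  (exp (-(β : ℂ) • bondHam κ g src tgt w)).trace

theorem isHermitian_bondHam [Fintype B] (κ g : ℝ) (src tgt : B → X) (w : B → ℂ) :
    (bondHam κ g src tgt w).IsHermitian := by
  unfold bondHam Matrix.IsHermitian
  rw [Matrix.conjTranspose_sum]
  exact Finset.sum_congr rfl fun b _ => isHermitian_bondTerm _ _ _ _ _

namespace BondMirror

variable {R : Reflection X} {src tgt : B → X} {w₀ : B → ℂ} {κ : ℝ} (D : BondMirror R src tgt w₀ κ)

/-- The contribution of a bond to the Hamiltonian of the left half. -/
noncomputable def halfTerm (R : Reflection X) (src tgt : B → X) (w₀ : B → ℂ) (κ g : ℝ)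
    (a : B → ℝ) (b : B) : Matrix (Finset R.spin.Half) (Finset R.spin.Half) ℂ :=
  if R.left (src b) ∧ R.left (tgt b) then
    bondTerm κ g (fun σ => ann (R.halfMode (src b) σ)) (fun σ => ann (R.halfMode (tgt b) σ))
      (twist w₀ a b)
  else 0

/-- The operators coupled by a bond, if it crosses. -/
noncomputable def crossTerm (R : Reflection X) (src tgt : B → X) (β κ g : ℝ)
    (p : B × (Option Spin × Bool)) : Matrix (Finset R.spin.Half) (Finset R.spin.Half) ℂ :=
  if R.left (src p.1) ↔ R.left (tgt p.1) then 0
  else crossOp β κ g (R.halfMode (src p.1)) p.2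

theorem conjMat_crossTerm (β g : ℝ) (p : B × (Option Spin × Bool)) :
    conjMat (crossTerm R src tgt β κ g p) = crossTerm R src tgt β κ g p := by
  unfold crossTerm
  split_ifs
  · exact map_zero _
  · exact conjMat_crossOp _ _ _ _ _

/-- For each bond only one of the three summands can be nonzero, according to whether it lies on the
left, on the right, or crosses. A right bond appears as the conjugate of its mirror image, with the
mirrored field. -/
theorem bondTerm_splitAnn {β g : ℝ} (hβ : 0 ≤ β) (hg : 0 ≤ g) (hne : ∀ b, src b ≠ tgt b)
    (a : B → ℝ) (b : B) :
    -(β : ℂ) • bondTerm κ g (fun σ => R.spin.splitAnn (fun p => D.ω p.1) (src b, σ))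
        (fun σ => R.spin.splitAnn (fun p => D.ω p.1) (tgt b, σ)) (twist w₀ a b) =
      (-(β : ℂ) • halfTerm R src tgt w₀ κ g a b) ⊗ₖ 1
        + 1 ⊗ₖ conjMat (-(β : ℂ) • halfTerm R src tgt w₀ κ g (D.mirror a) (D.ρ b))
        + ∑ k, crossAngle R src a (b, k) •
          (crossTerm R src tgt β κ g (b, k) ⊗ₖ crossTerm R src tgt β κ g (b, k)) := by
  have hl {x : X} (h : R.left x) (σ : Spin) :
      R.spin.splitAnn (fun p => D.ω p.1) (x, σ) = ann (R.halfMode x σ) ⊗ₖ 1 :=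
    R.spin.splitAnn_left _ h
  have hr {x : X} (h : ¬ R.left x) (σ : Spin) :
      R.spin.splitAnn (fun p => D.ω p.1) (x, σ) =
        D.ω x • (parity R.spin.Half ⊗ₖ (parity R.spin.Half * cre (R.halfMode x σ))) :=
    R.spin.splitAnn_right _ h
  have hβr : star (-(β : ℂ)) = -(β : ℂ) := by rw [star_neg]; congr 1; exact Complex.conj_ofReal β
  by_cases hs : R.left (src b) <;> by_cases ht : R.left (tgt b)
  · have h1 : ¬ (R.left (src (D.ρ b)) ∧ R.left (tgt (D.ρ b))) := by
      rw [D.left_ρ]; tauto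
    simp only [hl hs, hl ht, bondTerm_kronecker_one, halfTerm, hs, ht, crossTerm, h1, and_self,
      if_true, if_false, iff_self, smul_zero, map_zero, Matrix.kronecker_zero,
      Finset.sum_const_zero, add_zero, Matrix.smul_kronecker]
  · have h1 : ¬ (R.left (src (D.ρ b)) ∧ R.left (tgt (D.ρ b))) := by
      rw [D.left_ρ]; tauto
    obtain ⟨hm, hw⟩ := D.cross b hs ht
    have hh (σ) : R.halfMode (tgt b) σ = R.halfMode (src b) σ := by rw [hm, R.halfMode_r]
    simp only [hl hs, hr ht, halfTerm, hs, ht, crossTerm, h1, and_false, iff_false, not_true_eq_false,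
      if_false, smul_zero, map_zero, Matrix.kronecker_zero, Matrix.zero_kronecker, zero_add, hh]
    rw [bondTerm_cross hβ hg _ D.sgn_sq D.sgn_mul
      (u := Complex.exp (Complex.I * (a b : ℂ))) (by rw [twist, ← hw]; ring)]
    simp only [crossAngle, hs, if_true]
  · have h1 : ¬ (R.left (src (D.ρ b)) ∧ R.left (tgt (D.ρ b))) := by
      rw [D.left_ρ]; tauto
    obtain ⟨hm, hw⟩ := D.cross' b hs ht
    have hh : R.halfMode (src b) = R.halfMode (tgt b) := by rw [hm, R.halfMode_r]
    have hh' (σ) : R.halfMode (src b) σ = R.halfMode (tgt b) σ := by rw [hh]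
    rw [bondTerm_comm]
    simp only [hr hs, hl ht, halfTerm, hs, ht, crossTerm, h1, false_and, false_iff, not_true_eq_false,
      if_false, smul_zero, map_zero, Matrix.kronecker_zero, Matrix.zero_kronecker, zero_add, hh, hh']
    rw [bondTerm_cross hβ hg _ D.sgn_sq D.sgn_mul
      (u := Complex.exp (Complex.I * ((-a b : ℝ) : ℂ)))
      (by rw [twist, star_mul', star_exp_I_mul, ← hw]; ring)]
    simp only [crossAngle, hs, if_false]
  · have h1 : R.left (src (D.ρ b)) ∧ R.left (tgt (D.ρ b)) := by
      rw [D.left_ρ]; tauto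
    have hw := D.right b hs ht
    have e1 := D.omega_mul_star (src b)
    have e2 := D.omega_mul_star (tgt b)
    simp only [hr hs, hr ht, crossTerm, hs, ht, if_true, iff_self, halfTerm, h1, and_self, if_false,
      Matrix.kronecker_zero, Matrix.zero_kronecker, zero_add, smul_zero, Finset.sum_const_zero,
      add_zero, conjMat_smul, hβr, conjMat_bondTerm_ann, Matrix.kronecker_smul]
    rw [bondTerm_right _ _ (fun σ τ => R.halfMode_ne (hne b) (by tauto) σ τ)]
    congr 2
    rw [D.src_ρ, D.tgt_ρ, R.halfMode_r, R.halfMode_r]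
    by_cases hf : D.flip b = true
    -- If the reflection reverses the bond, exchanging its ends conjugates the phase once more.
    · simp only [hf, if_true] at hw ⊢
      rw [bondTerm_comm κ g _ _ (star _), star_star]
      congr 1
      rw [twist, twist, D.mirror_ρ, hf, if_pos rfl, star_mul', star_exp_I_mul, hw]
      simp only [star_neg, star_mul', star_star]
      linear_combination (w₀ (D.ρ b) * Complex.exp (Complex.I * ((-a b : ℝ) : ℂ))) *
        (D.ω (tgt b) * star (D.ω (tgt b)) * e1 + e2)
    · simp only [hf, Bool.false_eq_true, if_false] at hw ⊢
      congr 1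
      rw [twist, twist, D.mirror_ρ, if_neg hf, star_mul', star_mul', hw]
      simp only [star_neg, star_mul', star_star]
      linear_combination (star (w₀ (D.ρ b)) * star (Complex.exp (Complex.I * (a b : ℂ)))) *
        (D.ω (tgt b) * star (D.ω (tgt b)) * e1 + e2)

/-- The partition function in the split Fock space. -/
theorem bondZ_eq [Fintype B] {β g : ℝ} (hβ : 0 ≤ β) (hg : 0 ≤ g) (hne : ∀ b, src b ≠ tgt b) (a : B → ℝ) :
    bondZ β κ g src tgt (twist w₀ a) =
      (exp ((-(β : ℂ) • ∑ b, halfTerm R src tgt w₀ κ g a b) ⊗ₖ 1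
        + 1 ⊗ₖ conjMat (-(β : ℂ) • ∑ b, halfTerm R src tgt w₀ κ g (D.mirror a) b)
        + ∑ p, (crossAngle R src a p • crossTerm R src tgt β κ g p) ⊗ₖ
            crossTerm R src tgt β κ g p)).trace := by
  obtain ⟨Φ, hΦt, hΦ⟩ := R.spin.exists_starAlgHom_splitAnn (ω := fun p => D.ω p.1)
    (fun p => D.norm_ω p.1)
  rw [bondZ, ← hΦt, map_matrix_exp]
  congr 2
  rw [bondHam, Finset.smul_sum, map_sum]
  simp only [map_smul, map_bondTerm, hΦ, D.bondTerm_splitAnn hβ hg hne, Finset.sum_add_distrib]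
  congr 1
  · congr 1
    · rw [Finset.smul_sum]
      ext ⟨i, i'⟩ ⟨j, j'⟩
      simp only [Matrix.sum_apply, Matrix.kronecker_apply, Finset.sum_mul]
    · have hρ : ∑ b, halfTerm R src tgt w₀ κ g (D.mirror a) b =
          ∑ b, halfTerm R src tgt w₀ κ g (D.mirror a) (D.ρ b) :=
        (Equiv.sum_comp (Function.Involutive.toPerm D.ρ D.ρ_ρ) _).symm
      rw [hρ, Finset.smul_sum, map_sum]
      ext ⟨i, i'⟩ ⟨j, j'⟩
      simp only [Matrix.sum_apply, Matrix.kronecker_apply, Finset.mul_sum]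
  · rw [Fintype.sum_prod_type]
    simp only [Matrix.smul_kronecker]

/-- For a folded field the right Hamiltonian is the conjugate of the left one and the crossing
phases are `1`: this is the shape of the traces that bound in Cauchy–Schwarz. -/
theorem bondZ_fold_eq [Fintype B] {β g : ℝ} (hβ : 0 ≤ β) (hg : 0 ≤ g) (hne : ∀ b, src b ≠ tgt b) (a : B → ℝ) :
    bondZ β κ g src tgt (twist w₀ (D.fold a)) =
      (exp ((-(β : ℂ) • ∑ b, halfTerm R src tgt w₀ κ g a b) ⊗ₖ 1
        + 1 ⊗ₖ conjMat (-(β : ℂ) • ∑ b, halfTerm R src tgt w₀ κ g a b)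
        + ∑ p, crossTerm R src tgt β κ g p ⊗ₖ crossTerm R src tgt β κ g p)).trace := by
  have h1 (b) : halfTerm R src tgt w₀ κ g (D.fold a) b = halfTerm R src tgt w₀ κ g a b := by
    unfold halfTerm
    split_ifs with h
    · rw [twist, twist, D.fold_left a h]
    · rfl
  have h2 (b) : halfTerm R src tgt w₀ κ g (D.mirror (D.fold a)) b =
      halfTerm R src tgt w₀ κ g a b := by
    unfold halfTerm
    split_ifs with h
    · rw [twist, twist, D.mirror_fold_left a h]
    · rfl
  have h3 (p) : crossAngle R src (D.fold a) p • crossTerm R src tgt β κ g p =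
      crossTerm R src tgt β κ g p := by
    by_cases h : R.left (src p.1) ↔ R.left (tgt p.1)
    · simp [crossTerm, h]
    · rw [crossAngle, D.fold_cross a h]
      simp [crossPhase_one]
  rw [D.bondZ_eq hβ hg hne]
  simp only [h1, h2, h3]

/-- Reflection positivity. -/
theorem norm_bondZ_sq_le [Fintype B] {β g : ℝ} (hβ : 0 ≤ β) (hg : 0 ≤ g) (hne : ∀ b, src b ≠ tgt b)
    (a : B → ℝ) :
    ‖bondZ β κ g src tgt (twist w₀ a)‖ ^ 2 ≤
      (bondZ β κ g src tgt (twist w₀ (D.fold a))).re *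
        (bondZ β κ g src tgt (twist w₀ (D.fold (D.mirror a)))).re := by
  rw [D.bondZ_eq hβ hg hne, D.bondZ_fold_eq hβ hg hne, D.bondZ_fold_eq hβ hg hne]
  -- All crossing phases are placed in the left factors `C_p`. They have modulus one and cancel in
  -- `C_p ⊗ C̄_p`; the right factors carry none.
  refine (norm_sq_trace_exp_kronecker_le _ _ _ _).trans_eq ?_
  have hc (p : B × (Option Spin × Bool)) :
      (crossAngle R src a p • crossTerm R src tgt β κ g p) ⊗ₖ
        conjMat (crossAngle R src a p • crossTerm R src tgt β κ g p) =
      crossTerm R src tgt β κ g p ⊗ₖ crossTerm R src tgt β κ g p := by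
    rw [conjMat_smul, conjMat_crossTerm, Matrix.smul_kronecker, Matrix.kronecker_smul, smul_smul,
      Complex.star_def, Complex.mul_conj, Complex.normSq_eq_norm_sq, norm_crossAngle]
    simp
  simp only [hc, conjMat_crossTerm, conjMat_conjMat]

end BondMirror

end BondReflection

end PiFlux

namespace PiFlux

open NormedSpace Filter Topology

/-! ### Maximizers of the partition function -/

theorem trace_exp_hermitian {n : Type*} [Fintype n] [DecidableEq n] {A : Matrix n n ℂ}
    (hA : A.IsHermitian) (β : ℝ) :
    (exp (-(β : ℂ) • A)).trace = ((∑ i, Real.exp (-β * hA.eigenvalues i) : ℝ) : ℂ) := by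
  let U := hA.eigenvectorUnitary
  have hU : (U : Matrix n n ℂ) * star (U : Matrix n n ℂ) = 1 := Unitary.mul_star_self_of_mem U.2
  have hU' : star (U : Matrix n n ℂ) * (U : Matrix n n ℂ) = 1 := Unitary.star_mul_self_of_mem U.2
  have hunit : IsUnit (U : Matrix n n ℂ) := IsUnit.of_mul_eq_one _ hU
  have hinv : (U : Matrix n n ℂ)⁻¹ = star (U : Matrix n n ℂ) := Matrix.inv_eq_right_inv hU
  have h : -(β : ℂ) • A = (U : Matrix n n ℂ) *
      Matrix.diagonal (fun i => ((-β * hA.eigenvalues i : ℝ) : ℂ)) * (U : Matrix n n ℂ)⁻¹ := by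
    conv_lhs => rw [hA.spectral_theorem]
    rw [Unitary.conjStarAlgAut_apply, hinv, ← Matrix.smul_mul, ← Matrix.mul_smul, ← Matrix.diagonal_smul]
    congr 3
    ext i
    simp
  rw [h, Matrix.exp_conj _ _ hunit, Matrix.trace_mul_comm, ← mul_assoc, hinv, hU', one_mul,
    Matrix.exp_diagonal, Matrix.trace_diagonal]
  push_cast
  refine Finset.sum_congr rfl fun i _ => ?_
  rw [Pi.coe_exp, ← Complex.exp_eq_exp_ℂ]

theorem trace_exp_hermitian_im {n : Type*} [Fintype n] [DecidableEq n] {A : Matrix n n ℂ}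
    (hA : A.IsHermitian) (β : ℝ) : (exp (-(β : ℂ) • A)).trace.im = 0 := by
  rw [trace_exp_hermitian hA, Complex.ofReal_im]

theorem trace_exp_hermitian_pos {n : Type*} [Fintype n] [DecidableEq n] [Nonempty n]
    {A : Matrix n n ℂ} (hA : A.IsHermitian) (β : ℝ) : 0 < (exp (-(β : ℂ) • A)).trace.re := by
  rw [trace_exp_hermitian hA, Complex.ofReal_re]
  exact Finset.sum_pos (fun i _ => Real.exp_pos _) Finset.univ_nonempty

/-- Pointwise inequalities between partition functions imply inequalities between ground-state
energies. -/
theorem exists_isLeast_spectrum_le {n : Type*} [Fintype n] [DecidableEq n] [Nonempty n]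
    {A B : Matrix n n ℂ} (hA : A.IsHermitian) (hB : B.IsHermitian)
    (h : ∀ β : ℝ, 0 ≤ β →
      (exp (-(β : ℂ) • A)).trace.re ≤ (exp (-(β : ℂ) • B)).trace.re) :
    ∃ E₀ E : ℝ, IsLeast (spectrum ℝ B) E₀ ∧ IsLeast (spectrum ℝ A) E ∧ E₀ ≤ E := by
  have least {C : Matrix n n ℂ} (hC : C.IsHermitian) :
      ∃ i, IsLeast (spectrum ℝ C) (hC.eigenvalues i) := by
    obtain ⟨i, hi⟩ := Finite.exists_min hC.eigenvalues
    refine ⟨i, ?_⟩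
    rw [hC.spectrum_real_eq_range_eigenvalues]
    exact ⟨⟨i, rfl⟩, by rintro _ ⟨j, rfl⟩; exact hi j⟩
  obtain ⟨i, hi⟩ := least hB
  obtain ⟨j, hj⟩ := least hA
  refine ⟨_, _, hi, hj, ?_⟩
  have hmin (k) : hB.eigenvalues i ≤ hB.eigenvalues k := hi.2 (by
    rw [hB.spectrum_real_eq_range_eigenvalues]; exact ⟨k, rfl⟩)
  by_contra! hlt
  -- With `E_A`, `E_B` the lowest eigenvalues, `exp(-βE_A) ≤ Tr exp(-βA) ≤ Tr exp(-βB) ≤ n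
  -- exp(-βE_B)`, which fails for large `β` if `E_A < E_B`.
  have hbound (β : ℝ) (hβ : 0 ≤ β) :
      β * (hB.eigenvalues i - hA.eigenvalues j) ≤ Real.log (Fintype.card n) := by
    have h1 := h β hβ
    rw [trace_exp_hermitian hA, trace_exp_hermitian hB, Complex.ofReal_re, Complex.ofReal_re] at h1
    have h2 : Real.exp (-β * hA.eigenvalues j) ≤ ∑ k, Real.exp (-β * hA.eigenvalues k) :=
      Finset.single_le_sum (f := fun k => Real.exp (-β * hA.eigenvalues k))
        (fun k _ => (Real.exp_pos _).le) (Finset.mem_univ j)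
    have h3 : ∑ k, Real.exp (-β * hB.eigenvalues k) ≤
        Fintype.card n * Real.exp (-β * hB.eigenvalues i) := by
      calc _ ≤ ∑ _k : n, Real.exp (-β * hB.eigenvalues i) :=
            Finset.sum_le_sum fun k _ => Real.exp_le_exp.2 (by nlinarith [hmin k])
        _ = _ := by simp
    have h4 := h2.trans (h1.trans h3)
    have hc : (0 : ℝ) < Fintype.card n := by exact_mod_cast Fintype.card_pos
    rw [Real.le_log_iff_exp_le hc]
    have h5 : β * (hB.eigenvalues i - hA.eigenvalues j) =
      -β * hA.eigenvalues j - -β * hB.eigenvalues i := by ring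
    rwa [h5, Real.exp_sub, div_le_iff₀ (Real.exp_pos _)]
  have hpos : 0 < hB.eigenvalues i - hA.eigenvalues j := sub_pos.2 hlt
  have hlog : 0 ≤ Real.log (Fintype.card n) := Real.log_natCast_nonneg _
  have := hbound ((Real.log (Fintype.card n) + 1) / (hB.eigenvalues i - hA.eigenvalues j))
    (by positivity)
  rw [div_mul_cancel₀ _ hpos.ne'] at this
  linarith

section Maximizer

variable {X B : Type*}

open Classical in
/-- The number of bonds on which a gauge field vanishes. -/
noncomputable def zeros [Fintype B] (a : B → ℝ) : ℕ := ∑ b, if a b = 0 then 1 else 0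

namespace BondMirror

variable {R : Reflection X} {src tgt : B → X} {w₀ : B → ℂ} {κ : ℝ} (D : BondMirror R src tgt w₀ κ)

theorem mirror_eq_zero (a : B → ℝ) (b : B) : D.mirror a b = 0 ↔ a (D.ρ b) = 0 := by
  unfold mirror; split_ifs <;> simp

/-- The two folds use each half of `a` twice, so away from the planes they have together twice the
zeros of `a`. On crossing bonds both vanish, and at `b` this is a strict gain. -/
theorem zeros_fold_lt [Fintype B] (a : B → ℝ) {b : B} (hb : ¬ (R.left (src b) ↔ R.left (tgt b)))
    (hab : a b ≠ 0) : 2 * zeros a < zeros (D.fold a) + zeros (D.fold (D.mirror a)) := by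
  classical
  have hρ : zeros a = ∑ b, if a (D.ρ b) = 0 then 1 else 0 :=
    (Equiv.sum_comp (Function.Involutive.toPerm D.ρ D.ρ_ρ) (fun b => if a b = 0 then 1 else 0)).symm
  rw [two_mul]
  nth_rw 2 [hρ]
  unfold zeros
  rw [← Finset.sum_add_distrib, ← Finset.sum_add_distrib]
  have hpt (c : B) : (if a c = 0 then 1 else 0) + (if a (D.ρ c) = 0 then 1 else 0) ≤
      (if D.fold a c = 0 then 1 else 0) + (if D.fold (D.mirror a) c = 0 then 1 else 0) := by
    by_cases h1 : R.left (src c) ∧ R.left (tgt c)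
    · rw [D.fold_left _ h1, D.fold_left _ h1]
      simp only [mirror_eq_zero, le_refl]
    · by_cases h2 : ¬ R.left (src c) ∧ ¬ R.left (tgt c)
      · have e (a') : D.fold a' c = D.mirror a' c := by rw [fold, if_neg h1, if_pos h2]
        rw [e, e, D.mirror_mirror]
        simp only [mirror_eq_zero]
        rw [add_comm]
      · rw [D.fold_cross _ (by tauto), D.fold_cross _ (by tauto), if_pos rfl]
        split_ifs <;> simp
  refine Finset.sum_lt_sum (fun c _ => hpt c) ⟨b, Finset.mem_univ b, ?_⟩
  rw [D.fold_cross _ hb, D.fold_cross _ hb, if_neg hab, if_pos rfl]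
  split_ifs <;> simp

end BondMirror

variable [Fintype X] [DecidableEq X] [Fintype B]

theorem bondZ_pos (β κ g : ℝ) (src tgt : B → X) (w : B → ℂ) : 0 < (bondZ β κ g src tgt w).re :=
  trace_exp_hermitian_pos (isHermitian_bondHam κ g src tgt w) β

/-- If every bond crosses some reflection plane, then the partition function is maximal in the
absence of a gauge field. -/
theorem bondZ_twist_le {β κ g : ℝ} (hβ : 0 ≤ β) (hg : 0 ≤ g) {src tgt : B → X} {w₀ : B → ℂ}
    (hne : ∀ b, src b ≠ tgt b)
    (hD : ∀ b, ∃ R : Reflection X, Nonempty (BondMirror R src tgt w₀ κ) ∧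
      ¬ (R.left (src b) ↔ R.left (tgt b))) (a : B → ℝ) :
    (bondZ β κ g src tgt (twist w₀ a)).re ≤
      (bondZ β κ g src tgt (twist w₀ (fun _ => 0))).re := by
  classical
  -- Folding only copies, negates or erases values, so fields with values in this finite set stay
  -- among themselves and a maximizer exists without any compactness.
  let V : Finset ℝ := insert 0 (Finset.univ.image a ∪ Finset.univ.image fun b => -a b)
  have hV0 : (0 : ℝ) ∈ V := Finset.mem_insert_self _ _
  have hVneg (v : ℝ) (hv : v ∈ V) : -v ∈ V := by
    simp only [V, Finset.mem_insert, Finset.mem_union, Finset.mem_image, Finset.mem_univ,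
      true_and] at hv ⊢
    rcases hv with rfl | ⟨b, rfl⟩ | ⟨b, rfl⟩
    · left; simp
    · right; right; exact ⟨b, rfl⟩
    · right; left; exact ⟨b, by simp⟩
  let S : Finset (B → ℝ) := Fintype.piFinset fun _ => V
  have haS : a ∈ S := Fintype.mem_piFinset.2 fun b => by simp [V]
  let Zf (c : B → ℝ) : ℝ := (bondZ β κ g src tgt (twist w₀ c)).re
  -- Lexicographic order: largest partition function first, then most zeros.
  obtain ⟨c, hcS, hc⟩ := S.exists_max_image (fun c => toLex (Zf c, zeros c)) ⟨a, haS⟩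
  have hmax (c') (h : c' ∈ S) : Zf c' ≤ Zf c := by
    rcases Prod.Lex.le_iff.1 (hc c' h) with h | h
    exacts [le_of_lt h, le_of_eq h.1]
  have hmax' (c') (h : c' ∈ S) (hZ : Zf c ≤ Zf c') : zeros c' ≤ zeros c := by
    rcases Prod.Lex.le_iff.1 (hc c' h) with h | h
    exacts [absurd hZ (not_le.2 h), h.2]
  have hzero : c = fun _ => 0 := by
    by_contra hne0
    obtain ⟨b, hb⟩ := Function.ne_iff.1 hne0
    obtain ⟨R, ⟨D⟩, hcross⟩ := hD b
    have hmS (c') (h : c' ∈ S) : D.mirror c' ∈ S := Fintype.mem_piFinset.2 fun b => by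
      have := Fintype.mem_piFinset.1 h (D.ρ b)
      unfold BondMirror.mirror
      split_ifs
      exacts [hVneg _ this, this]
    have hfS (c') (h : c' ∈ S) : D.fold c' ∈ S := Fintype.mem_piFinset.2 fun b => by
      unfold BondMirror.fold
      split_ifs
      exacts [Fintype.mem_piFinset.1 h b, Fintype.mem_piFinset.1 (hmS c' h) b, hV0]
    have h1 := hfS c hcS
    have h2 := hfS _ (hmS c hcS)
    have hpos : 0 < Zf c := bondZ_pos _ _ _ _ _ _
    have hpos1 : 0 < Zf (D.fold c) := bondZ_pos _ _ _ _ _ _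
    have hrp : Zf c ^ 2 ≤ Zf (D.fold c) * Zf (D.fold (D.mirror c)) :=
      le_trans (pow_le_pow_left₀ hpos.le (Complex.re_le_norm _) 2)
        (D.norm_bondZ_sq_le hβ hg hne c)
    -- Since neither factor in `hrp` exceeds `Zf c`, both must equal it; the two folds are
    -- maximizers as well.
    have e1 : Zf c ≤ Zf (D.fold c) := by
      have := hrp.trans (mul_le_mul_of_nonneg_left (hmax _ h2) hpos1.le)
      rw [pow_two] at this
      exact le_of_mul_le_mul_right this hpos
    have e2 : Zf c ≤ Zf (D.fold (D.mirror c)) := by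
      have := hrp.trans (mul_le_mul_of_nonneg_right (hmax _ h1) (bondZ_pos _ _ _ _ _ _).le)
      rw [pow_two] at this
      exact le_of_mul_le_mul_left this hpos
    have := D.zeros_fold_lt c hcross hb
    have := hmax' _ h1 e1
    have := hmax' _ h2 e2
    omega
  have := hmax a haS
  rwa [hzero] at this

end Maximizer

end PiFlux

namespace PiFlux

/-! ### Signs on the periodic lattice -/

section Lattice

variable {d L : ℕ}

/-- The parity sign of a coordinate. -/
noncomputable def coordSign (c : ZMod (2 * L)) : ℂ := (-1) ^ c.valMinAbs

/-- The side length `2L` is even, so parity is well defined on the periodic lattice. -/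
theorem neg_one_zpow_eq_of_intCast_eq {a b : ℤ} (h : (a : ZMod (2 * L)) = b) :
    (-1 : ℂ) ^ a = (-1) ^ b := by
  have h1 : ((2 * L : ℕ) : ℤ) ∣ b - a := (ZMod.intCast_eq_intCast_iff_dvd_sub a b _).1 h
  obtain ⟨k, hk⟩ := h1
  have : b = a + 2 * (L * k) := by push_cast at hk; linarith
  rw [this, zpow_add₀ (by norm_num), zpow_mul]
  norm_num

theorem coordSign_intCast (z : ℤ) : coordSign (z : ZMod (2 * L)) = (-1) ^ z :=
  neg_one_zpow_eq_of_intCast_eq (ZMod.coe_valMinAbs _)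

theorem coordSign_add (a b : ZMod (2 * L)) : coordSign (a + b) = coordSign a * coordSign b := by
  rw [← ZMod.coe_valMinAbs a, ← ZMod.coe_valMinAbs b, ← Int.cast_add, coordSign_intCast,
    coordSign_intCast, coordSign_intCast, zpow_add₀ (by norm_num)]

theorem coordSign_one : coordSign (1 : ZMod (2 * L)) = -1 := by
  simpa using coordSign_intCast (L := L) 1

theorem coordSign_mul_self (c : ZMod (2 * L)) : coordSign c * coordSign c = 1 := by
  rw [coordSign, ← mul_zpow]; norm_num

theorem coordSign_reflect (p c : ZMod (2 * L)) : coordSign (2 * p + 1 - c) = -coordSign c := by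
  have h : coordSign (2 * p + 1 - c) * coordSign c = -1 := by
    rw [← coordSign_add, sub_add_cancel, coordSign_add, two_mul, coordSign_add, coordSign_mul_self,
      coordSign_one, one_mul]
  linear_combination coordSign c * h - coordSign (2 * p + 1 - c) * coordSign_mul_self c

/-- The sign `(-1)^{x^{(1)} + ⋯ + x^{(i-1)}}`. -/
noncomputable def stagger (i : Fin d) (x : Site d L) : ℂ :=
  ∏ j ∈ Finset.univ.filter (fun j : Fin d => j < i), coordSign (x j)

theorem stagger_mul_self (i : Fin d) (x : Site d L) : stagger i x * stagger i x = 1 := by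
  rw [stagger, ← Finset.prod_mul_distrib]
  exact Finset.prod_eq_one fun j _ => coordSign_mul_self _

theorem stagger_update (i j : Fin d) (x : Site d L) {v : ZMod (2 * L)}
    (hv : coordSign v = -coordSign (x j)) :
    stagger i (Function.update x j v) = (if j < i then -1 else 1) * stagger i x := by
  unfold stagger
  split_ifs with h
  · have hm : j ∈ Finset.univ.filter (fun j : Fin d => j < i) := by simp [h]
    rw [← Finset.mul_prod_erase _ _ hm, ← Finset.mul_prod_erase _ (fun j => coordSign (x j)) hm,
      Function.update_self, hv]
    have : ∏ k ∈ (Finset.univ.filter fun j : Fin d => j < i).erase j,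
        coordSign (Function.update x j v k) =
        ∏ k ∈ (Finset.univ.filter fun j : Fin d => j < i).erase j, coordSign (x k) :=
      Finset.prod_congr rfl fun k hk => by
        rw [Function.update_of_ne (Finset.ne_of_mem_erase hk)]
    rw [this]; ring
  · rw [one_mul]
    refine Finset.prod_congr rfl fun k hk => ?_
    rw [Function.update_of_ne]
    rintro rfl
    exact h (Finset.mem_filter.1 hk).2

theorem add_e_eq_update (x : Site d L) (j : Fin d) : x + e j = Function.update x j (x j + 1) := by
  funext k
  by_cases h : k = j
  · subst h; simp [e]
  · simp [e, h]

theorem stagger_add_e (i j : Fin d) (x : Site d L) :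
    stagger i (x + e j) = (if j < i then -1 else 1) * stagger i x := by
  rw [add_e_eq_update, stagger_update]
  rw [coordSign_add, coordSign_one]; ring

/-- The sign of the antiperiodic boundary condition. -/
noncomputable def seamSign (c : ZMod (2 * L)) : ℂ := if c = (L : ZMod (2 * L)) then -1 else 1

theorem seamSign_mul_self (c : ZMod (2 * L)) : seamSign c * seamSign c = 1 := by
  unfold seamSign; split_ifs <;> norm_num

theorem valMinAbs_eq_iff (c : ZMod (2 * L)) : c.valMinAbs = (L : ℤ) ↔ c = (L : ZMod (2 * L)) := by
  constructor
  · intro h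
    rw [← ZMod.coe_valMinAbs c, h, Int.cast_natCast]
  · rintro rfl
    exact ZMod.valMinAbs_natCast_of_le_half (by omega)

theorem neg_one_zpow_theta (i : Fin d) (x : Site d L) :
    (-1 : ℂ) ^ theta i x = stagger i x * seamSign (x i) := by
  have hprod (s : Finset (Fin d)) :
      (-1 : ℂ) ^ (∑ j ∈ s, (x j).valMinAbs) = ∏ j ∈ s, coordSign (x j) := by
    induction s using Finset.induction_on with
    | empty => simp
    | insert a s ha ih =>
      rw [Finset.sum_insert ha, Finset.prod_insert ha, zpow_add₀ (by norm_num), ih]; rfl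
  rw [theta, zpow_add₀ (by norm_num), hprod, stagger, seamSign]
  simp only [valMinAbs_eq_iff]
  split_ifs <;> simp

theorem hopPhase_zero (x : Site d L) (i : Fin d) :
    hopPhase 0 x i = Complex.I * (stagger i x * seamSign (x i)) := by
  rw [hopPhase, neg_one_zpow_theta]; simp

/-- A step along `e_j` flips `stagger i` exactly when `j < i`, so exactly one of the two pairs of
opposite bonds has unequal signs. Opposite bonds share the same seam sign, which cancels. -/
theorem fluxPhase_zero (x : Site d L) {i j : Fin d} (hij : i ≠ j) :
    fluxPhase (0 : GaugeField d L) x i j = -1 := by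
  have inv (x : Site d L) (i : Fin d) : (hopPhase 0 x i)⁻¹ = -hopPhase 0 x i := by
    refine inv_eq_of_mul_eq_one_right ?_
    rw [hopPhase_zero]
    linear_combination (-(stagger i x * stagger i x * (seamSign (x i) * seamSign (x i)))) * Complex.I_sq
      + seamSign (x i) * seamSign (x i) * stagger_mul_self i x + seamSign_mul_self (x i)
  have ei : (x + e j : Site d L) i = x i := by simp [e, hij]
  have ej : (x + e i : Site d L) j = x j := by simp [e, hij.symm]
  rw [fluxPhase, inv, inv]
  simp only [hopPhase_zero, stagger_add_e, ei, ej]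
  have h1 := stagger_mul_self i x
  have h2 := stagger_mul_self j x
  have h3 := seamSign_mul_self (x i)
  have h4 := seamSign_mul_self (x j)
  have hs : (if i < j then (-1 : ℂ) else 1) * (if j < i then -1 else 1) = -1 := by
    rcases lt_or_gt_of_ne hij with h | h
    · rw [if_pos h, if_neg h.not_gt]; ring
    · rw [if_neg h.not_gt, if_pos h]; ring
  calc _ = Complex.I ^ 2 * Complex.I ^ 2 * (stagger i x * stagger i x) *
        (stagger j x * stagger j x) * (seamSign (x i) * seamSign (x i)) *
        (seamSign (x j) * seamSign (x j)) *
        ((if i < j then (-1 : ℂ) else 1) * (if j < i then -1 else 1)) := by ring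
    _ = -1 := by rw [h1, h2, h3, h4, hs, Complex.I_sq]; ring

/-! ### Reflections of the periodic lattice -/

/-- The distance of a coordinate from the plane, counted on the right. -/
def offset (p c : ZMod (2 * L)) : ℕ := (c - p - 1).val

theorem natCast_inj_of_lt {a b : ℕ} (ha : a < 2 * L) (hb : b < 2 * L) :
    (a : ZMod (2 * L)) = b ↔ a = b := by
  rw [ZMod.natCast_eq_natCast_iff', Nat.mod_eq_of_lt ha, Nat.mod_eq_of_lt hb]

theorem offset_lt [NeZero L] (p c : ZMod (2 * L)) : offset p c < 2 * L := ZMod.val_lt _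

theorem eq_of_offset [NeZero L] (p c : ZMod (2 * L)) : c = p + 1 + (offset p c : ZMod (2 * L)) := by
  rw [offset, ZMod.natCast_zmod_val]; ring

theorem offset_eq {p c : ZMod (2 * L)} {k : ℕ} (hk : k < 2 * L) (h : c = p + 1 + (k : ZMod (2 * L))) :
    offset p c = k := by
  rw [offset, h, show p + 1 + (k : ZMod (2 * L)) - p - 1 = k by ring, ZMod.val_natCast_of_lt hk]

theorem two_mul_natCast_self : (2 * (L : ZMod (2 * L))) = 0 := by
  exact_mod_cast ZMod.natCast_self (2 * L)

theorem offset_reflect [NeZero L] (p c : ZMod (2 * L)) : offset p (2 * p + 1 - c) = 2 * L - 1 - offset p c := by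
  have h := offset_lt p c
  apply offset_eq (by omega)
  rw [Nat.cast_sub (by omega), Nat.cast_sub (by omega)]
  push_cast
  rw [two_mul_natCast_self]
  linear_combination -eq_of_offset p c

theorem offset_add_one [NeZero L] {p c : ZMod (2 * L)} (h : offset p c + 1 < 2 * L) :
    offset p (c + 1) = offset p c + 1 := by
  apply offset_eq h
  push_cast
  linear_combination eq_of_offset p c

theorem offset_add_one_of_last [NeZero L] {p c : ZMod (2 * L)} (h : offset p c + 1 = 2 * L) :
    c = p ∧ offset p (c + 1) = 0 := by
  have h1 : ((offset p c + 1 : ℕ) : ZMod (2 * L)) = 0 := by rw [h]; exact ZMod.natCast_self _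
  push_cast at h1
  have h2 : c = p := by linear_combination eq_of_offset p c + h1
  have hL := NeZero.pos L
  refine ⟨h2, offset_eq (by omega) ?_⟩
  rw [h2]; simp

/-- The part of the gauge transformation that depends on the coordinate along the reflection. -/
noncomputable def seamGauge (p c : ZMod (2 * L)) : ℂ :=
  -- `(L - p).val` is the distance from `p` to the seam bond. For `c` on the right, the first
  -- condition says that the seam has been passed on the way up from `p` to `c`, the second that its
  -- mirror image has.
  if ((L : ZMod (2 * L)) - p).val ≤ offset p c ∨
    2 * L ≤ ((L : ZMod (2 * L)) - p).val + offset p c then -1 else 1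

theorem seamGauge_mul_self (p c : ZMod (2 * L)) : seamGauge p c * seamGauge p c = 1 := by
  unfold seamGauge; split_ifs <;> norm_num

theorem eq_natCast_iff [NeZero L] (p : ZMod (2 * L)) {c : ZMod (2 * L)} {k : ℕ} (hk : k < 2 * L)
    (h : c = p + k) : c = (L : ZMod (2 * L)) ↔ ((L : ZMod (2 * L)) - p).val = k := by
  rw [← natCast_inj_of_lt (ZMod.val_lt _) hk, ZMod.natCast_zmod_val, h]
  constructor
  · intro h; linear_combination -h
  · intro h; linear_combination -h

theorem seamSign_eq_seamGauge_first [NeZero L] {p : ZMod (2 * L)} : seamSign p = seamGauge p (p + 1) := by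
  have hL := NeZero.pos L
  have h0 : offset p (p + 1) = 0 := offset_eq (by omega) (by simp)
  have hm : ((L : ZMod (2 * L)) - p).val < 2 * L := ZMod.val_lt _
  have h1 := eq_natCast_iff p (c := p) (k := 0) (by omega) (by simp)
  rw [seamSign, seamGauge, h0, if_congr h1 rfl rfl]
  exact if_congr (by omega) rfl rfl

/-- On the way to `p + L` exactly one of the seam and its mirror image is passed, unless the seam is
the bond leaving `p + L`. The minus sign, an effect of antiperiodicity, compensates `star w = -w` at
the second plane, which bonds cross from right to left. -/
theorem seamSign_eq_neg_seamGauge_last [NeZero L] {p c : ZMod (2 * L)} (h : offset p c + 1 = L) :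
    seamSign c = -seamGauge p c := by
  have hL := NeZero.pos L
  have hm : ((L : ZMod (2 * L)) - p).val < 2 * L := ZMod.val_lt _
  have h1 := eq_natCast_iff p (c := c) (k := offset p c + 1) (by omega)
    (by push_cast; linear_combination eq_of_offset p c)
  rw [seamSign, seamGauge, if_congr h1 rfl rfl]
  by_cases h2 : ((L : ZMod (2 * L)) - p).val = offset p c + 1
  · rw [if_pos h2, if_neg (by omega)]
  · rw [if_neg h2, if_pos (by omega)]; norm_num

/-- Inside the right half the gauge changes sign just across the seam bond or the mirror image of
the seam bond. -/
theorem seamSign_mul_seamGauge [NeZero L] {p c : ZMod (2 * L)} (h : offset p c + 1 < L) :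
    seamSign c = seamSign (2 * p - c) * seamGauge p c * seamGauge p (c + 1) := by
  have hL := NeZero.pos L
  have hm : ((L : ZMod (2 * L)) - p).val < 2 * L := ZMod.val_lt _
  have h1 := eq_natCast_iff p (c := c) (k := offset p c + 1) (by omega)
    (by push_cast; linear_combination eq_of_offset p c)
  have h2 := eq_natCast_iff p (c := 2 * p - c) (k := 2 * L - (offset p c + 1)) (by omega) (by
    rw [Nat.cast_sub (by omega)]
    push_cast
    rw [two_mul_natCast_self]
    linear_combination -eq_of_offset p c)
  rw [seamSign, seamSign, seamGauge, seamGauge, offset_add_one (by omega), if_congr h1 rfl rfl,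
    if_congr h2 rfl rfl]
  split_ifs <;> first | (exfalso; omega) | norm_num

/-- The reflection that exchanges the coordinates `p` and `p + 1` in direction `i`. -/
def latticeReflection [NeZero L] (i : Fin d) (p : ZMod (2 * L)) : Reflection (Site d L) where
  r x := Function.update x i (2 * p + 1 - x i)
  -- Offsets `0, …, L - 1`, that is the coordinates `p + 1, …, p + L`, form the right half; the
  -- second plane separates `p + L` from `p + L + 1`.
  left x := L ≤ offset p (x i)
  decLeft _ := inferInstance
  r_r x := by simp
  left_r x := by
    have := offset_lt p (x i)
    rw [Function.update_self, offset_reflect]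
    omega

theorem reflect_add_e_self [NeZero L] (i : Fin d) (p : ZMod (2 * L)) (x : Site d L) :
    (latticeReflection i p).r (x + e i) + e i = (latticeReflection i p).r x := by
  funext k
  by_cases h : k = i
  · subst h
    simp only [latticeReflection, add_e_eq_update, Function.update_self, Function.update_idem]
    ring
  · simp [latticeReflection, e, h]

theorem reflect_add_e_of_ne [NeZero L] {i j : Fin d} (h : j ≠ i) (p : ZMod (2 * L)) (x : Site d L) :
    (latticeReflection i p).r (x + e j) = (latticeReflection i p).r x + e j := by
  simp only [latticeReflection, add_e_eq_update, Function.update_of_ne h, Function.update_of_ne h.symm]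
  exact Function.update_comm h _ _ _

theorem stagger_reflect [NeZero L] (i j : Fin d) (p : ZMod (2 * L)) (x : Site d L) :
    stagger j ((latticeReflection i p).r x) = (if i < j then -1 else 1) * stagger j x :=
  stagger_update _ _ _ (coordSign_reflect _ _)

/-- A real sign `s` with `s κ = |κ|`. -/
noncomputable def realSign (κ : ℝ) : ℝ := if 0 ≤ κ then 1 else -1

theorem realSign_sq (κ : ℝ) : realSign κ ^ 2 = 1 := by
  unfold realSign; split_ifs <;> norm_num

theorem realSign_mul (κ : ℝ) : realSign κ * κ = |κ| := by
  unfold realSign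
  split_ifs with h
  · rw [one_mul, abs_of_nonneg h]
  · rw [abs_of_neg (not_le.1 h)]; ring

/-- The gauge transformation that makes the hopping phases reflection symmetric. -/
noncomputable def mirrorGauge (κ : ℝ) (i : Fin d) (p : ZMod (2 * L)) (x : Site d L) : ℂ :=
  -((realSign κ : ℂ) * Complex.I * (stagger i x * seamGauge p (x i)))

theorem star_stagger (i : Fin d) (x : Site d L) : star (stagger i x) = stagger i x := by
  rw [stagger, star_prod]
  exact Finset.prod_congr rfl fun j _ => by simp [coordSign]

theorem star_seamSign (c : ZMod (2 * L)) : star (seamSign c) = seamSign c := by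
  unfold seamSign; split_ifs <;> simp

theorem star_seamGauge (p c : ZMod (2 * L)) : star (seamGauge p c) = seamGauge p c := by
  unfold seamGauge; split_ifs <;> simp

theorem norm_eq_one_of_mul_self {z : ℂ} (h : z * z = 1) : ‖z‖ = 1 := by
  have h1 : ‖z‖ * ‖z‖ = 1 := by rw [← norm_mul, h, norm_one]
  nlinarith [norm_nonneg z]

theorem star_hopPhase_zero (x : Site d L) (i : Fin d) : star (hopPhase 0 x i) = -hopPhase 0 x i := by
  rw [hopPhase_zero, star_mul', star_mul', star_stagger, star_seamSign, Complex.star_def,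
    Complex.conj_I, neg_mul]

theorem star_mirrorGauge (κ : ℝ) (i : Fin d) (p : ZMod (2 * L)) (x : Site d L) :
    star (mirrorGauge κ i p x) = -mirrorGauge κ i p x := by
  rw [mirrorGauge, star_neg, star_mul', star_mul', star_mul', star_stagger, star_seamGauge,
    Complex.star_def, Complex.conj_I, Complex.conj_ofReal]
  ring

/-- The lattice with flux `π` through every plaquette is symmetric under the reflections. -/
noncomputable def latticeMirror [NeZero L] (κ : ℝ) (i : Fin d) (p : ZMod (2 * L)) :
    BondMirror (latticeReflection i p) (fun b : Site d L × Fin d => b.1) (fun b => b.1 + e b.2)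
      (fun b => hopPhase 0 b.1 b.2) κ where
  ω := mirrorGauge κ i p
  norm_ω x := by
    have h1 := norm_eq_one_of_mul_self (stagger_mul_self i x)
    have h2 := norm_eq_one_of_mul_self (seamGauge_mul_self p (x i))
    have h3 : |realSign κ| = 1 := by unfold realSign; split_ifs <;> simp
    simp [mirrorGauge, h1, h2, h3]
  sgn := realSign κ
  sgn_sq := realSign_sq κ
  sgn_mul := realSign_mul κ
  ρ b := ((latticeReflection i p).r (if b.2 = i then b.1 + e i else b.1), b.2)
  ρ_ρ := by
    rintro ⟨x, j⟩
    by_cases h : j = i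
    · subst h
      simp only [if_true, reflect_add_e_self, Reflection.r_r]
    · simp only [if_neg h, Reflection.r_r]
  flip b := decide (b.2 = i)
  flip_ρ _ := rfl
  src_ρ := by
    rintro ⟨x, j⟩
    by_cases h : j = i
    · subst h; simp
    · simp [h]
  tgt_ρ := by
    rintro ⟨x, j⟩
    by_cases h : j = i
    · subst h
      simp only [if_true, reflect_add_e_self, decide_true]
    · simp only [if_neg h, decide_eq_true_eq, reflect_add_e_of_ne h]
  right := by
    rintro ⟨x, j⟩ hs ht
    have hS : (realSign κ : ℂ) ^ 2 = 1 := by exact_mod_cast realSign_sq κ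
    have hw := stagger_mul_self i x
    by_cases h : j = i
    -- For bonds along the reflection the phases are imaginary, so conjugation by the flip supplies
    -- the required sign.
    · subst h
      simp only [latticeReflection, not_le, add_e_eq_update, Function.update_self] at hs ht
      have hL := offset_lt p (x j)
      rw [offset_add_one (by omega)] at ht
      have hg := seamSign_mul_seamGauge ht
      simp only [decide_true, if_true, star_hopPhase_zero, star_mirrorGauge]
      simp only [hopPhase_zero, mirrorGauge, stagger_reflect, stagger_add_e, lt_irrefl, if_false,
        one_mul]
      have e1 : (x + e j : Site d L) j = x j + 1 := by simp [e]
      have e2 : (latticeReflection j p).r (x + e j) j = 2 * p - x j := by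
        simp only [latticeReflection, e1, Function.update_self]; ring
      rw [e1, e2, hg]
      linear_combination (Complex.I * stagger j x * seamSign (2 * p - x j) * seamGauge p (x j) *
        seamGauge p (x j + 1)) * ((realSign κ : ℂ) ^ 2 * stagger j x * stagger j x *
          Complex.I_sq - (realSign κ : ℂ) ^ 2 * hw - hS)
    · simp only [h, decide_false, Bool.false_eq_true, if_false, star_mirrorGauge]
      simp only [hopPhase_zero, mirrorGauge, stagger_reflect, stagger_add_e]
      have e1 : (x + e j : Site d L) i = x i := by simp [e, Ne.symm h]
      have e2 : (latticeReflection i p).r x j = x j := by simp [latticeReflection, h]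
      rw [e1, e2]
      have hg := seamGauge_mul_self p (x i)
      -- The flux `π` enters here: of the sign from reflecting `stagger j` and the sign from the
      -- gauge `stagger i` along `e_j`, exactly one is `-1`, and it cancels the particle-hole sign.
      have hsgn : (if i < j then (-1 : ℂ) else 1) * (if j < i then -1 else 1) = -1 := by
        rcases lt_or_gt_of_ne h with h | h
        · rw [if_neg h.not_gt, if_pos h]; ring
        · rw [if_pos h, if_neg h.not_gt]; ring
      calc _ = -(-1) * (1 : ℂ) * 1 * 1 * (Complex.I * (stagger j x * seamSign (x j))) := by ring
        _ = -((if i < j then (-1 : ℂ) else 1) * (if j < i then -1 else 1)) * (realSign κ : ℂ) ^ 2 *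
            (stagger i x * stagger i x) * (seamGauge p (x i) * seamGauge p (x i)) *
            (Complex.I * (stagger j x * seamSign (x j))) := by rw [hsgn, hS, hw, hg]
        _ = _ := by
          linear_combination (-((if i < j then (-1 : ℂ) else 1) * (if j < i then -1 else 1)) *
            (realSign κ : ℂ) ^ 2 * (stagger i x * stagger i x) *
            (seamGauge p (x i) * seamGauge p (x i)) *
            (Complex.I * (stagger j x * seamSign (x j)))) * Complex.I_sq
  cross := by
    rintro ⟨x, j⟩ hs ht
    by_cases h : j = i
    · subst h
      simp only [latticeReflection, not_le, add_e_eq_update, Function.update_self] at hs ht ⊢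
      have hL := offset_lt p (x j)
      have hlast : offset p (x j) + 1 = 2 * L := by
        by_contra hc
        rw [offset_add_one (by omega)] at ht
        omega
      have hx := (offset_add_one_of_last hlast).1
      refine ⟨by rw [hx]; congr 1; ring, ?_⟩
      have hw := stagger_mul_self j x
      have hg := seamGauge_mul_self p (p + 1)
      rw [← add_e_eq_update, hopPhase_zero, mirrorGauge, stagger_add_e, if_neg (lt_irrefl _)]
      have e1 : (x + e j : Site d L) j = x j + 1 := by simp [e]
      rw [e1, hx, seamSign_eq_seamGauge_first]
      linear_combination (-(realSign κ : ℂ)) * (stagger j x * stagger j x * seamGauge p (p + 1) *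
        seamGauge p (p + 1) * Complex.I_sq - seamGauge p (p + 1) * seamGauge p (p + 1) * hw - hg)
    · exact absurd hs (by simpa [latticeReflection, add_e_eq_update, Ne.symm h] using ht)
  cross' := by
    rintro ⟨x, j⟩ hs ht
    by_cases h : j = i
    · subst h
      simp only [latticeReflection, not_le, add_e_eq_update, Function.update_self] at hs ht ⊢
      have hlast : offset p (x j) + 1 = L := by
        rw [offset_add_one (by omega)] at ht
        omega
      have hx : x j = 2 * p + 1 - (x j + 1) := by
        have h1 := eq_of_offset p (x j)
        have h2 : ((offset p (x j) + 1 : ℕ) : ZMod (2 * L)) = L := by rw [hlast]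
        push_cast at h2
        linear_combination 2 * h1 + 2 * h2 + two_mul_natCast_self (L := L)
      refine ⟨by rw [Function.update_idem, ← hx, Function.update_eq_self], ?_⟩
      have hw := stagger_mul_self j x
      have hg := seamGauge_mul_self p (x j)
      rw [star_hopPhase_zero, hopPhase_zero, mirrorGauge, seamSign_eq_neg_seamGauge_last hlast]
      linear_combination (-(realSign κ : ℂ)) * (stagger j x * stagger j x * seamGauge p (x j) *
        seamGauge p (x j) * Complex.I_sq - seamGauge p (x j) * seamGauge p (x j) * hw - hg)
    · exact absurd ht (by simpa [latticeReflection, add_e_eq_update, Ne.symm h] using hs)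

/-! ### Application to the lattice Hamiltonian. -/

theorem H_eq_bondHam [NeZero L] (κ g : ℝ) (A : GaugeField d L) :
    H κ g A = bondHam κ g (fun b : Site d L × Fin d => b.1) (fun b => b.1 + e b.2)
      (twist (fun b => hopPhase 0 b.1 b.2) fun b => A b.1 b.2) := by
  have hbond (x : Site d L) (i : Fin d) :
      bondTerm κ g (fun σ => ann (x, σ)) (fun σ => ann (x + e i, σ))
        (twist (fun b => hopPhase 0 b.1 b.2) (fun b => A b.1 b.2) (x, i)) =
      ∑ σ, (Complex.I * (κ : ℂ)) • ((-1 : ℂ) ^ theta i x) •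
        (Complex.exp (Complex.I * (A x i : ℂ)) • (cre (x, σ) * ann (x + e i, σ))
          - Complex.exp (-(Complex.I * (A x i : ℂ))) • (cre (x + e i, σ) * ann (x, σ)))
      + (g : ℂ) • (Complex.exp (2 * Complex.I * (A x i : ℂ)) •
        (cre (x, up) * cre (x, down) * ann (x + e i, down) * ann (x + e i, up))
      + Complex.exp (-(2 * Complex.I * (A x i : ℂ))) •
        (cre (x + e i, up) * cre (x + e i, down) * ann (x, down) * ann (x, up))) := by
    have h1 := stagger_mul_self i x
    have h2 := seamSign_mul_self (x i)
    have e1 : Complex.exp (2 * Complex.I * (A x i : ℂ)) = Complex.exp (Complex.I * (A x i : ℂ)) ^ 2 := by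
      rw [← Complex.exp_nat_mul]; congr 1; push_cast; ring
    have e2 : Complex.exp (-(2 * Complex.I * (A x i : ℂ))) =
        Complex.exp (-(Complex.I * (A x i : ℂ))) ^ 2 := by
      rw [← Complex.exp_nat_mul]; congr 1; push_cast; ring
    have e3 : star (Complex.exp (Complex.I * (A x i : ℂ))) = Complex.exp (-(Complex.I * (A x i : ℂ))) := by
      rw [star_exp_I_mul]; congr 1; push_cast; ring
    -- The square of the background phase is `-1`, which turns the `-g` of `bondTerm` into the `+g`
    -- of `Hint`.
    have h3 : (Complex.I * (stagger i x * seamSign (x i))) ^ 2 = -1 := by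
      linear_combination (stagger i x * stagger i x * (seamSign (x i) * seamSign (x i))) *
        Complex.I_sq - seamSign (x i) * seamSign (x i) * h1 - h2
    have hc (k : Mode d L) : (ann k)ᴴ = cre k := rfl
    simp only [bondTerm, twist, star_mul', star_hopPhase_zero, e3, e1, e2, hc,
      mul_pow _ (Complex.exp _), neg_sq, Fintype.sum_bool]
    simp only [hopPhase_zero, neg_one_zpow_theta, h3]
    module
  rw [bondHam, Fintype.sum_prod_type]
  simp only [hbond, Finset.sum_add_distrib]
  rw [H, Hhop, Hint]
  congr 1
  · simp only [Finset.smul_sum]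
    rw [Finset.sum_comm]
    refine Finset.sum_congr rfl fun x _ => Finset.sum_comm
  · simp only [Finset.smul_sum, smul_add, Finset.sum_add_distrib]

theorem site_ne_add_e [NeZero L] (x : Site d L) (i : Fin d) : x ≠ x + e i := by
  intro h
  have h1 := congrFun h i
  rw [add_e_eq_update, Function.update_self] at h1
  have h2 : (1 : ZMod (2 * L)) = 0 := by linear_combination -h1
  have h3 := (natCast_inj_of_lt (L := L) (a := 1) (b := 0) (by have := NeZero.pos L; omega)
    (by have := NeZero.pos L; omega)).1 (by simpa using h2)
  omega

/-- With `p = x i` the bond joins offset `2L - 1`, the last on the left, to offset `0`, the first on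
the right. -/
theorem latticeReflection_crosses [NeZero L] (x : Site d L) (i : Fin d) :
    ¬ ((latticeReflection i (x i)).left x ↔ (latticeReflection i (x i)).left (x + e i)) := by
  have hL := NeZero.pos L
  have h1 : offset (x i) (x i) = 2 * L - 1 := offset_eq (by omega) (by
    rw [Nat.cast_sub (by omega)]; push_cast; rw [two_mul_natCast_self]; ring)
  have h2 := (offset_add_one_of_last (p := x i) (c := x i) (by omega)).2
  simp only [latticeReflection, add_e_eq_update, Function.update_self, h1, h2]
  omega

theorem exists_latticeMirror [NeZero L] (κ : ℝ) (b : Site d L × Fin d) : ∃ R : Reflection (Site d L),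
    Nonempty (BondMirror R (fun b : Site d L × Fin d => b.1) (fun b => b.1 + e b.2)
      (fun b => hopPhase 0 b.1 b.2) κ) ∧ ¬ (R.left b.1 ↔ R.left (b.1 + e b.2)) :=
  ⟨latticeReflection b.2 (b.1 b.2), ⟨latticeMirror κ b.2 (b.1 b.2)⟩,
    latticeReflection_crosses b.1 b.2⟩

theorem Z_eq_bondZ [NeZero L] (β κ g : ℝ) (A : GaugeField d L) :
    Z β κ g A = bondZ β κ g (fun b : Site d L × Fin d => b.1) (fun b => b.1 + e b.2)
      (twist (fun b => hopPhase 0 b.1 b.2) fun b => A b.1 b.2) := by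
  unfold Z bondZ
  rw [H_eq_bondHam]

theorem Z_re_le [NeZero L] {β κ g : ℝ} (hβ : 0 ≤ β) (hg : 0 ≤ g) (A : GaugeField d L) :
    (Z β κ g A).re ≤ (Z β κ g (0 : GaugeField d L)).re := by
  have h := bondZ_twist_le (X := Site d L) (B := Site d L × Fin d) (src := fun b => b.1)
    (tgt := fun b => b.1 + e b.2) (w₀ := fun b => hopPhase 0 b.1 b.2) (κ := κ) hβ hg
    (fun b => site_ne_add_e b.1 b.2) (exists_latticeMirror κ) fun b => A b.1 b.2
  rw [Z_eq_bondZ, Z_eq_bondZ]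
  exact h

end Lattice

end PiFlux

theorem theorem1 (d L : ℕ) [NeZero L] (κ g : ℝ) (hg : 0 ≤ g) :
    (∀ A : PiFlux.GaugeField d L,
      (PiFlux.H κ g A).IsHermitian ∧
      (∀ β : ℝ, 0 ≤ β →
        (PiFlux.Z β κ g A).im = 0 ∧
        (PiFlux.Z β κ g A).re ≤ (PiFlux.Z β κ g (0 : PiFlux.GaugeField d L)).re) ∧
      (∃ E₀ E : ℝ,
        IsLeast (spectrum ℝ (PiFlux.H κ g (0 : PiFlux.GaugeField d L))) E₀ ∧
        IsLeast (spectrum ℝ (PiFlux.H κ g A)) E ∧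
        E₀ ≤ E)) ∧
    (∀ (x : PiFlux.Site d L) (i j : Fin d), i ≠ j →
      PiFlux.fluxPhase (0 : PiFlux.GaugeField d L) x i j = -1) := by
  have hH (A : PiFlux.GaugeField d L) : (PiFlux.H κ g A).IsHermitian := by
    rw [PiFlux.H_eq_bondHam]
    exact PiFlux.isHermitian_bondHam _ _ _ _ _
  exact ⟨fun A => ⟨hH A,
    fun β hβ => ⟨PiFlux.trace_exp_hermitian_im (hH A) β, PiFlux.Z_re_le hβ hg A⟩,
    PiFlux.exists_isLeast_spectrum_le (hH A) (hH 0) fun β hβ => PiFlux.Z_re_le hβ hg A⟩,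
    fun x i j hij => PiFlux.fluxPhase_zero x hij⟩
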